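/- Let $\varepsilon$ be a measurable field of real symmetric $3\times 3$ matrices on $\mathbb{R}^3$ with bounded entries, uniformly positive definite (there is $c>0$ with $\xi\cdot\varepsilon(x)\xi\ge c|\xi|^2$ for all $x,\xi\in\mathbb{R}^3$), and such that $\varepsilon-I$ has compact support. Let $U\subseteq\mathbb{R}^3$ be an open set that contains the support of $\varepsilon-I$, and let $\mathbf F^{\mathrm{in}}\in H^2(U;\mathbb{R}^3)$ satisfy $\Delta\mathbf F^{\mathrm{in}}=0$ in $U$. A solution of the vector electrostatic scattering problem is a vector field $\mathbf F\in H^2_{loc}(\mathbb{R}^3;\mathbb{R}^3)$ such that $$\Delta\mathbf F+(\varepsilon-I)\nabla\nabla\cdot\mathbf F=-(\varepsilon-I)\nabla\nabla\cdot\mathbf F^{\mathrm{in}}\quad\text{almost everywhere in }\mathbb{R}^3$$ (the right-hand side being $0$ outside the support of $\varepsilon-I$) and $\mathbf F(x)=o(1)$ as $|x|\to\infty$, uniformly in all directions. Theorem (Uniqueness). The vector electrostatic scattering problem has at most one solution: any two solutions with the same $\varepsilon$, $U$ and $\mathbf F^{\mathrm{in}}$ are equal almost everywhere. -/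

import Mathlib

open MeasureTheory
open scoped ContDiff Matrix

namespace Electrostatic

/-- Euclidean three-space, with its Euclidean norm and Lebesgue measure. -/
abbrev E3 : Type := EuclideanSpace ℝ (Fin 3)

/-- `g` is the weak partial derivative `∂u/∂x_i` on the open set `U`:
`∫ u ∂_i ψ = - ∫ g ψ` for every `ψ ∈ C_c^∞(U)`. Values outside `U` play no role. -/
def HasWeakPartial (U : Set E3) (i : Fin 3) (u g : E3 → ℝ) : Prop :=
  LocallyIntegrableOn u U ∧ LocallyIntegrableOn g U ∧
    ∀ ψ : E3 → ℝ, ContDiff ℝ ∞ ψ → HasCompactSupport ψ → tsupport ψ ⊆ U →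
      ∫ x, u x * fderiv ℝ ψ x (EuclideanSpace.single i 1) = - ∫ x, g x * ψ x

open Classical in
/-- The weak partial derivative `∂u/∂x_i` on `U`, unique up to equality a.e. on `U`
(and `0` by convention if there is none). -/
noncomputable def weakPartial (U : Set E3) (i : Fin 3) (u : E3 → ℝ) : E3 → ℝ :=
  if h : ∃ g, HasWeakPartial U i u g then h.choose else 0

/-- The Sobolev space `H^k(U)`: `u` and its weak derivatives of order at most `k` are
in `L^2(U)`. -/
def MemH (U : Set E3) : ℕ → (E3 → ℝ) → Prop
  | 0, u => MemLp u 2 (volume.restrict U)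
  | k + 1, u => MemLp u 2 (volume.restrict U) ∧
      ∀ i, ∃ g, HasWeakPartial U i u g ∧ MemH U k g

/-- `u ∈ L^2_loc(ℝ^3)`. -/
def MemL2loc (u : E3 → ℝ) : Prop :=
  ∀ K : Set E3, IsCompact K → MemLp u 2 (volume.restrict K)

/-- The local Sobolev space `H^k_loc(ℝ^3)`. -/
def MemHloc : ℕ → (E3 → ℝ) → Prop
  | 0, u => MemL2loc u
  | k + 1, u => MemL2loc u ∧ ∀ i, ∃ g, HasWeakPartial Set.univ i u g ∧ MemHloc k g

/-- The (weak) scalar Laplacian `Δu = ∑_j ∂_j ∂_j u` on `U`. -/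
noncomputable def weakLaplacian (U : Set E3) (u : E3 → ℝ) : E3 → ℝ :=
  fun x => ∑ j, weakPartial U j (weakPartial U j u) x

/-- The vector Laplacian `ΔF`, taken componentwise. -/
noncomputable def weakVecLaplacian (U : Set E3) (F : E3 → E3) : E3 → Fin 3 → ℝ :=
  fun x i => weakLaplacian U (fun y => F y i) x

/-- The (weak) divergence `∇·F = ∑_j ∂_j F_j` on `U`. -/
noncomputable def weakDiv (U : Set E3) (F : E3 → E3) : E3 → ℝ :=
  fun x => ∑ j, weakPartial U j (fun y => F y j) x

/-- The (weak) gradient of the divergence, `∇∇·F`, on `U`. -/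
noncomputable def weakGradDiv (U : Set E3) (F : E3 → E3) : E3 → Fin 3 → ℝ :=
  fun x i => weakPartial U i (weakDiv U F) x

/-- The standing assumptions on the coefficient: `ε` is a (measurable) field of real symmetric
matrices with bounded entries, uniformly positive definite, with `ε - I` compactly supported. -/
structure IsCoefficient (ε : E3 → Matrix (Fin 3) (Fin 3) ℝ) : Prop where
  measurable : ∀ i j, Measurable fun x => ε x i j
  symm : ∀ x, (ε x).IsSymm
  bounded : ∃ M : ℝ, ∀ x i j, |ε x i j| ≤ M
  elliptic : ∃ c : ℝ, 0 < c ∧ ∀ (x : E3) (ξ : Fin 3 → ℝ), c * (ξ ⬝ᵥ ξ) ≤ ξ ⬝ᵥ (ε x *ᵥ ξ)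
  compactSupport : HasCompactSupport fun x => ε x - 1

/-- An incoming field: an `H^2` field, harmonic on an open set `U` that contains the support
of `ε - I`. -/
structure IsIncoming (ε : E3 → Matrix (Fin 3) (Fin 3) ℝ) (U : Set E3) (Finc : E3 → E3) :
    Prop where
  isOpen : IsOpen U
  support_subset : tsupport (fun x => ε x - 1) ⊆ U
  memH2 : ∀ i, MemH U 2 (fun x => Finc x i)
  harmonic : ∀ᵐ x ∂(volume.restrict U), weakVecLaplacian U Finc x = 0

/-- `F(x) = o(1)` as `|x| → ∞`, uniformly in all directions (`F` being given up to
equality a.e.). -/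
def DecaysAtInfinity (F : E3 → E3) : Prop :=
  ∀ δ : ℝ, 0 < δ → ∃ R : ℝ, ∀ᵐ x : E3, R ≤ ‖x‖ → ‖F x‖ ≤ δ

/-- `F` solves the vector electrostatic scattering problem with coefficient `ε` and incoming
field `Finc` on `U`. The right-hand side of the equation vanishes off the support of `ε - I`,
so that only the values of `∇∇·Finc` in `U` matter. -/
structure IsVectorSolution (ε : E3 → Matrix (Fin 3) (Fin 3) ℝ) (U : Set E3) (Finc : E3 → E3)
    (F : E3 → E3) : Prop where
  memH2loc : ∀ i, MemHloc 2 (fun x => F x i)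
  equation : ∀ᵐ x : E3,
    weakVecLaplacian Set.univ F x + (ε x - 1) *ᵥ weakGradDiv Set.univ F x
      = - ((ε x - 1) *ᵥ weakGradDiv U Finc x)
  decay : DecaysAtInfinity F

end Electrostatic

/-!
# Uniqueness for the vector electrostatic scattering problem

The difference `F` of two solutions satisfies `ΔF + (ε - I)∇∇·F = 0` and tends to zero at infinity.
Put `u = ∇·F`. Then `ε∇u = ∇u - ΔF`, and the right-hand side is divergence free because the
Laplacian commutes with the divergence; so `u` is an entire weak solution of `∇·(ε∇u) = 0`
(`integral_coefficient_gradDiv_eq_zero`). Everything else is energy estimates.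

The tool is the Caccioppoli inequality `caccioppoli`: a weak solution of `∇·(A∇v) = 0` satisfies
`∫ η²|∇v|² ≤ C ∫ |∇η|² v²`. Its test function `η²v` is reached by mollifying `v`, which works for
merely measurable `A` since mollifications converge weakly in `L²_loc`
(`tendsto_integral_mul_moll`).
It has two consequences.

* Off a large ball `F` is bounded and harmonic, so `∫ |∇F|² = O(R^{-2}) O(R³) = O(R)` over the
  annulus of radii `R` and `2R` (`exists_growth_grad`).
* An entire weak solution `v` with `∫ v² = O(R)` over these annuli has zero gradient, since
  the Dirichlet integral over the ball of radius `R` is `O(R^{-2}) O(R)`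
  (`ae_grad_eq_zero_of_growth`).

The Liouville theorem of the second point applies to `u`, whence `∇∇·F = 0` and `F` is harmonic on
the whole space. It then applies, with `A = I`, to each partial derivative of `F`, so that the
Hessian of `F` vanishes. The mollifications of `F` are therefore affine functions tending to zero at
infinity, hence zero (`ae_eq_zero_of_hessian_eq_zero`), and `F = 0`. The incoming field
cancels in the difference.
-/

namespace Electrostatic

open Filter Topology Set

/-! ### Partial derivatives of smooth functions -/

/-- The classical partial derivative `∂ψ/∂x_i`. -/
noncomputable abbrev pd (i : Fin 3) (ψ : E3 → ℝ) : E3 → ℝ :=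
  fun x => fderiv ℝ ψ x (EuclideanSpace.single i 1)

theorem contDiff_pd {ψ : E3 → ℝ} (h : ContDiff ℝ ∞ ψ) (i : Fin 3) : ContDiff ℝ ∞ (pd i ψ) :=
  (h.fderiv_right (m := ∞) (by simp)).clm_apply contDiff_const

theorem hasCompactSupport_pd {ψ : E3 → ℝ} (h : HasCompactSupport ψ) (i : Fin 3) :
    HasCompactSupport (pd i ψ) :=
  h.fderiv_apply ℝ _

theorem pd_mul {ψ χ : E3 → ℝ} (hψ : ContDiff ℝ ∞ ψ) (hχ : ContDiff ℝ ∞ χ) (i : Fin 3) (x : E3) :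
    pd i (fun y => ψ y * χ y) x = ψ x * pd i χ x + χ x * pd i ψ x := by
  have h1 := (hψ.differentiable (by simp)) x
  have h2 := (hχ.differentiable (by simp)) x
  simp only [pd]
  rw [fderiv_fun_mul h1 h2]
  simp

theorem pd_comm {ψ : E3 → ℝ} (hψ : ContDiff ℝ ∞ ψ) (i j : Fin 3) :
    pd i (pd j ψ) = pd j (pd i ψ) := by
  funext x
  have hd : Differentiable ℝ (fderiv ℝ ψ) :=
    (hψ.fderiv_right (m := ∞) (by simp)).differentiable (by simp)
  have key : ∀ a b : Fin 3, pd a (pd b ψ) x =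
      fderiv ℝ (fderiv ℝ ψ) x (EuclideanSpace.single a 1) (EuclideanSpace.single b 1) := by
    intro a b
    simp only [pd]
    rw [fderiv_clm_apply (hd x) (differentiableAt_const _)]
    simp
  rw [key, key]
  have hs : IsSymmSndFDerivAt ℝ ψ x := by
    apply ContDiffAt.isSymmSndFDerivAt (n := ∞) hψ.contDiffAt
    simpa using ENat.LEInfty.out
  exact hs _ _

/-! ### Locally square-integrable functions -/

namespace MemL2loc

variable {u v : E3 → ℝ}

theorem locallyIntegrable (hu : MemL2loc u) : LocallyIntegrable u volume := by
  rw [locallyIntegrable_iff]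
  intro K hK
  have : IsFiniteMeasure (volume.restrict K) := ⟨by simpa using hK.measure_lt_top⟩
  exact (hu K hK).integrable (by norm_num)

theorem sub (hu : MemL2loc u) (hv : MemL2loc v) : MemL2loc (fun x => u x - v x) :=
  fun K hK => (hu K hK).sub (hv K hK)

theorem sum {f : Fin 3 → E3 → ℝ} (hf : ∀ i, MemL2loc (f i)) :
    MemL2loc (fun x => ∑ i, f i x) :=
  fun K hK => memLp_finsetSum _ fun i _ => hf i K hK

theorem bdd_mul {M : ℝ} (hu : Measurable u) (hM : ∀ x, |u x| ≤ M) (hv : MemL2loc v) :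
    MemL2loc (fun x => u x * v x) :=
  fun K hK => (hv K hK).of_le_mul (c := M)
    (hu.aestronglyMeasurable.mul (hv K hK).aestronglyMeasurable)
    (ae_of_all _ fun x => by
      rw [norm_mul]; exact mul_le_mul_of_nonneg_right (hM x) (norm_nonneg _))

theorem of_continuous (hu : Continuous u) : MemL2loc u := by
  intro K hK
  have : IsFiniteMeasure (volume.restrict K) := ⟨by simpa using hK.measure_lt_top⟩
  obtain ⟨C, hC⟩ := hK.exists_bound_of_continuousOn hu.continuousOn
  exact MemLp.of_bound hu.aestronglyMeasurable C
    ((ae_restrict_iff' hK.measurableSet).2 (ae_of_all _ hC))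

theorem memLp_continuous_mul {χ : E3 → ℝ} (hχ : Continuous χ) (hχs : HasCompactSupport χ)
    (hu : MemL2loc u) : MemLp (fun x => χ x * u x) 2 volume := by
  obtain ⟨C, hC⟩ := hχs.exists_bound_of_continuous hχ
  have h1 : MemLp (fun x => χ x * u x) 2 (volume.restrict (tsupport χ)) :=
    (hu _ hχs).of_le_mul (c := C)
      (hχ.aestronglyMeasurable.mul (hu _ hχs).aestronglyMeasurable)
      (ae_of_all _ fun x => by
        rw [norm_mul]; exact mul_le_mul_of_nonneg_right (hC x) (norm_nonneg _))
  have h2 := (memLp_indicator_iff_restrict (isClosed_tsupport χ).measurableSet).2 h1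
  rwa [indicator_eq_self.2] at h2
  intro x hx
  apply subset_tsupport
  intro h0
  simp [h0] at hx

theorem integrable_mul_mul {χ : E3 → ℝ} (hχ : Continuous χ) (hχs : HasCompactSupport χ)
    (hu : MemL2loc u) (hv : MemL2loc v) : Integrable (fun x => χ x * (u x * v x)) := by
  obtain ⟨C, hC⟩ := hχs.exists_bound_of_continuous hχ
  have h1 : IntegrableOn (fun x => χ x * (u x * v x)) (tsupport χ) := by
    refine Integrable.bdd_mul (c := C) ?_ hχ.aestronglyMeasurable (ae_of_all _ hC)
    exact (hu _ hχs).integrable_mul (hv _ hχs)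
  refine (integrableOn_iff_integrable_of_support_subset ?_).1 h1
  intro x hx
  apply subset_tsupport
  intro h0
  simp [h0] at hx

theorem integrable_mul {χ : E3 → ℝ} (hχ : Continuous χ) (hχs : HasCompactSupport χ)
    (hu : MemL2loc u) : Integrable (fun x => u x * χ x) := by
  have := integrable_mul_mul hχ hχs hu (of_continuous (u := fun _ => (1 : ℝ)) continuous_const)
  convert this using 2
  ring

theorem integrableOn_sq (hu : MemL2loc u) {K : Set E3} (hK : IsCompact K) :
    IntegrableOn (fun x => u x ^ 2) K := by
  exact (hu K hK).integrable_sq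

end MemL2loc

/-! ### Weak partial derivatives on the whole space -/

namespace HasWeakPartial

variable {i : Fin 3} {u v f g : E3 → ℝ}

theorem locallyIntegrable_left (h : HasWeakPartial univ i u g) : LocallyIntegrable u volume :=
  locallyIntegrableOn_univ.1 h.1

theorem locallyIntegrable_right (h : HasWeakPartial univ i u g) : LocallyIntegrable g volume :=
  locallyIntegrableOn_univ.1 h.2.1

theorem integral_pd (h : HasWeakPartial univ i u g) {ψ : E3 → ℝ} (hψ : ContDiff ℝ ∞ ψ)
    (hs : HasCompactSupport ψ) : ∫ x, u x * pd i ψ x = - ∫ x, g x * ψ x :=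
  h.2.2 ψ hψ hs (subset_univ _)

theorem congr (h : HasWeakPartial univ i u g) (hu : u =ᵐ[volume] v) (hg : g =ᵐ[volume] f) :
    HasWeakPartial univ i v f := by
  refine ⟨locallyIntegrableOn_univ.2 (h.locallyIntegrable_left.congr hu),
    locallyIntegrableOn_univ.2 (h.locallyIntegrable_right.congr hg), fun ψ hψ hs _ => ?_⟩
  have h1 : ∫ x, v x * fderiv ℝ ψ x (EuclideanSpace.single i 1) = ∫ x, u x * pd i ψ x :=
    integral_congr_ae (by filter_upwards [hu] with x hx; simp [hx])
  have h2 : ∫ x, f x * ψ x = ∫ x, g x * ψ x :=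
    integral_congr_ae (by filter_upwards [hg] with x hx; simp [hx])
  rw [h1, h2, h.integral_pd hψ hs]

theorem ae_eq (h : HasWeakPartial univ i u g) (h' : HasWeakPartial univ i u f) :
    g =ᵐ[volume] f := by
  refine ae_eq_of_integral_contDiff_smul_eq h.locallyIntegrable_right h'.locallyIntegrable_right
    fun ψ hψ hs => ?_
  have h1 := h.integral_pd hψ hs
  have h2 := h'.integral_pd hψ hs
  simp only [smul_eq_mul, mul_comm (ψ _)]
  linarith

theorem weakPartial_ae_eq (h : HasWeakPartial univ i u g) (huv : v =ᵐ[volume] u) :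
    weakPartial univ i v =ᵐ[volume] g := by
  have hv : HasWeakPartial univ i v g := h.congr huv.symm EventuallyEq.rfl
  have hex : ∃ g, HasWeakPartial univ i v g := ⟨g, hv⟩
  rw [weakPartial, dif_pos hex]
  exact hex.choose_spec.ae_eq hv

theorem integrable_mul_of_locallyIntegrable (hu : LocallyIntegrable u volume)
    {χ : E3 → ℝ} (hχ : Continuous χ) (hχs : HasCompactSupport χ) :
    Integrable (fun x => u x * χ x) := by
  simpa [mul_comm] using hu.integrable_smul_left_of_hasCompactSupport hχ hχs

theorem sum {u g : Fin 3 → E3 → ℝ} (h : ∀ j, HasWeakPartial univ i (u j) (g j)) :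
    HasWeakPartial univ i (fun x => ∑ j, u j x) (fun x => ∑ j, g j x) := by
  refine ⟨locallyIntegrableOn_univ.2 ?_, locallyIntegrableOn_univ.2 ?_, fun ψ hψ hs _ => ?_⟩
  · simp only [Fin.sum_univ_three]
    exact ((h 0).locallyIntegrable_left.add (h 1).locallyIntegrable_left).add
      (h 2).locallyIntegrable_left
  · simp only [Fin.sum_univ_three]
    exact ((h 0).locallyIntegrable_right.add (h 1).locallyIntegrable_right).add
      (h 2).locallyIntegrable_right
  · simp only [Finset.sum_mul]
    rw [integral_finsetSum, integral_finsetSum, ← Finset.sum_neg_distrib]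
    · exact Finset.sum_congr rfl fun j _ => (h j).integral_pd hψ hs
    · exact fun j _ => integrable_mul_of_locallyIntegrable (h j).locallyIntegrable_right
        hψ.continuous hs
    · exact fun j _ => integrable_mul_of_locallyIntegrable (h j).locallyIntegrable_left
        (contDiff_pd hψ i).continuous (hasCompactSupport_pd hs i)

theorem sub (h : HasWeakPartial univ i u g) (h' : HasWeakPartial univ i v f) :
    HasWeakPartial univ i (fun x => u x - v x) (fun x => g x - f x) := by
  refine ⟨locallyIntegrableOn_univ.2 (h.locallyIntegrable_left.sub h'.locallyIntegrable_left),
    locallyIntegrableOn_univ.2 (h.locallyIntegrable_right.sub h'.locallyIntegrable_right),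
    fun ψ hψ hs _ => ?_⟩
  have e1 := integrable_mul_of_locallyIntegrable h.locallyIntegrable_left
    (contDiff_pd hψ i).continuous (hasCompactSupport_pd hs i)
  have e2 := integrable_mul_of_locallyIntegrable h'.locallyIntegrable_left
    (contDiff_pd hψ i).continuous (hasCompactSupport_pd hs i)
  have e3 := integrable_mul_of_locallyIntegrable h.locallyIntegrable_right hψ.continuous hs
  have e4 := integrable_mul_of_locallyIntegrable h'.locallyIntegrable_right hψ.continuous hs
  simp only [sub_mul]
  rw [integral_sub e1 e2, integral_sub e3 e4, h.integral_pd hψ hs, h'.integral_pd hψ hs]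
  ring

end HasWeakPartial

/-- `v` is in `H^1_loc(ℝ^3)`, with weak gradient `g`. -/
structure IsWeakGrad (v : E3 → ℝ) (g : Fin 3 → E3 → ℝ) : Prop where
  memL2loc : MemL2loc v
  memL2loc_grad : ∀ i, MemL2loc (g i)
  hasWeakPartial : ∀ i, HasWeakPartial univ i v (g i)

/-! ### Mollification -/

/-- A sequence of smooth bump functions around the origin whose supports shrink to it. -/
noncomputable def bump (k : ℕ) : ContDiffBump (0 : E3) where
  rIn := 1 / (2 * ((k : ℝ) + 1))
  rOut := 1 / ((k : ℝ) + 1)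
  rIn_pos := by positivity
  rIn_lt_rOut := by
    apply one_div_lt_one_div_of_lt
    · positivity
    · have : (0 : ℝ) ≤ k := k.cast_nonneg
      linarith

/-- The `k`-th mollifying kernel: smooth, nonnegative, of integral one. -/
noncomputable def mollKernel (k : ℕ) : E3 → ℝ := (bump k).normed volume

/-- The `k`-th mollification of `v`. -/
noncomputable def moll (k : ℕ) (v : E3 → ℝ) : E3 → ℝ :=
  fun x => ∫ t, v t * mollKernel k (x - t)

theorem tendsto_bump_rOut : Tendsto (fun k => (bump k).rOut) atTop (𝓝 0) :=
  tendsto_one_div_add_atTop_nhds_zero_nat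

theorem bump_rOut_le_one (k : ℕ) : (bump k).rOut ≤ 1 := by
  change 1 / ((k : ℝ) + 1) ≤ 1
  rw [div_le_one (by positivity)]
  have : (0 : ℝ) ≤ k := k.cast_nonneg
  linarith

theorem contDiff_mollKernel (k : ℕ) : ContDiff ℝ ∞ (mollKernel k) := (bump k).contDiff_normed

theorem mollKernel_nonneg (k : ℕ) (x : E3) : 0 ≤ mollKernel k x := (bump k).nonneg_normed x

theorem integrable_mollKernel (k : ℕ) : Integrable (mollKernel k) volume :=
  (bump k).integrable_normed

theorem integral_mollKernel (k : ℕ) : ∫ x, mollKernel k x = 1 := (bump k).integral_normed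

theorem hasCompactSupport_mollKernel (k : ℕ) : HasCompactSupport (mollKernel k) :=
  (bump k).hasCompactSupport_normed

theorem mollKernel_eq_zero {k : ℕ} {x : E3} (h : 1 ≤ ‖x‖) : mollKernel k x = 0 := by
  by_contra hne
  have : x ∈ Function.support ((bump k).normed volume) := hne
  rw [ContDiffBump.support_normed_eq, mem_ball_zero_iff] at this
  linarith [bump_rOut_le_one k]

theorem moll_eq_convolution (k : ℕ) (v : E3 → ℝ) :
    moll k v = convolution v (mollKernel k) (ContinuousLinearMap.lsmul ℝ ℝ) volume := by
  funext x
  simp [moll, convolution_def]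

theorem moll_eq_convolution' (k : ℕ) (v : E3 → ℝ) :
    moll k v = convolution (mollKernel k) v (ContinuousLinearMap.lsmul ℝ ℝ) volume := by
  funext x
  simp [moll, convolution_eq_swap, mul_comm]

theorem moll_eq_integral_swap (k : ℕ) (v : E3 → ℝ) (x : E3) :
    moll k v x = ∫ t, mollKernel k t * v (x - t) := by
  rw [moll_eq_convolution']
  simp [convolution_def]

theorem contDiff_moll (k : ℕ) {v : E3 → ℝ} (hv : LocallyIntegrable v volume) :
    ContDiff ℝ ∞ (moll k v) := by
  rw [moll_eq_convolution]
  exact (hasCompactSupport_mollKernel k).contDiff_convolution_right _ hv (contDiff_mollKernel k)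

theorem integrable_mul_mollKernel (k : ℕ) {v : E3 → ℝ} (hv : LocallyIntegrable v volume)
    (x : E3) : Integrable (fun t => v t * mollKernel k (x - t)) volume := by
  have h := (hasCompactSupport_mollKernel k).convolutionExists_right
    (ContinuousLinearMap.lsmul ℝ ℝ) hv (contDiff_mollKernel k).continuous x
  simpa [ConvolutionExistsAt] using h

theorem moll_sub (k : ℕ) {u v : E3 → ℝ} (hu : LocallyIntegrable u volume)
    (hv : LocallyIntegrable v volume) (x : E3) :
    moll k (fun y => u y - v y) x = moll k u x - moll k v x := by
  simp only [moll, sub_mul]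
  exact integral_sub (integrable_mul_mollKernel k hu x) (integrable_mul_mollKernel k hv x)

theorem moll_congr (k : ℕ) {u v : E3 → ℝ} (h : u =ᵐ[volume] v) : moll k u = moll k v := by
  funext x
  exact integral_congr_ae (by filter_upwards [h] with t ht; simp [ht])

/-- The mollifying kernels live in the unit ball, so that the mollification at `x` only sees
the unit ball around `x`. -/
theorem moll_congr_near {k : ℕ} {u v : E3 → ℝ} {x : E3} (h : ∀ t, ‖x - t‖ < 1 → u t = v t) :
    moll k u x = moll k v x := by
  refine integral_congr_ae (ae_of_all _ fun t => ?_)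
  rcases lt_or_ge ‖x - t‖ 1 with h1 | h1
  · simp [h t h1]
  · simp [mollKernel_eq_zero h1]

/-- A bound for `|u|` on the unit ball around `x` bounds the mollification at `x`. -/
theorem abs_moll_le {k : ℕ} {u : E3 → ℝ} {x : E3} {C : ℝ}
    (h : ∀ᵐ t, ‖x - t‖ < 1 → |u t| ≤ C) : |moll k u x| ≤ C := by
  have hint : Integrable (fun t => C * mollKernel k (x - t)) volume :=
    ((integrable_mollKernel k).comp_sub_left x).const_mul C
  have h1 : ‖moll k u x‖ ≤ ∫ t, C * mollKernel k (x - t) := by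
    refine norm_integral_le_of_norm_le hint ?_
    filter_upwards [h] with t ht
    rw [norm_mul, Real.norm_of_nonneg (mollKernel_nonneg k _)]
    rcases lt_or_ge ‖x - t‖ 1 with h1 | h1
    · exact mul_le_mul_of_nonneg_right (ht h1) (mollKernel_nonneg k _)
    · simp [mollKernel_eq_zero h1]
  rwa [integral_const_mul, integral_sub_left_eq_self (mollKernel k), integral_mollKernel, mul_one]
    at h1

/-- Mollification commutes with weak differentiation: the derivative falls on the kernel, and
the kernel, centred at `x`, is a test function. -/
theorem pd_moll (k : ℕ) {i : Fin 3} {v g : E3 → ℝ} (h : HasWeakPartial univ i v g) :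
    pd i (moll k v) = moll k g := by
  funext x
  have hsm := contDiff_mollKernel k
  have hcs := hasCompactSupport_mollKernel k
  have h1 := (hcs.hasFDerivAt_convolution_right (ContinuousLinearMap.lsmul ℝ ℝ)
    h.locallyIntegrable_left (hsm.of_le (by simp)) x).fderiv
  have h2 : pd i (moll k v) x = ∫ t, v t * pd i (mollKernel k) (x - t) := by
    simp only [pd]
    rw [moll_eq_convolution, h1, convolution_precompR_apply _ h.locallyIntegrable_left
      (hcs.fderiv ℝ) (hsm.continuous_fderiv (by simp))]
    simp [convolution_def]
  have hψ : ContDiff ℝ ∞ (fun t => mollKernel k (x - t)) :=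
    hsm.comp (contDiff_const.sub contDiff_id)
  have hψs : HasCompactSupport (fun t => mollKernel k (x - t)) :=
    hcs.comp_homeomorph (Homeomorph.subLeft x)
  have h3 : ∀ t, pd i (fun t => mollKernel k (x - t)) t = - pd i (mollKernel k) (x - t) := by
    intro t
    simp only [pd]
    have hd : DifferentiableAt ℝ (mollKernel k) (x - t) := hsm.differentiable (by simp) _
    have hc := hd.hasFDerivAt.comp t ((hasFDerivAt_id t).const_sub x)
    have hc' : fderiv ℝ (fun t => mollKernel k (x - t)) t = _ := hc.fderiv
    rw [hc']
    simp
  have h4 := h.integral_pd hψ hψs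
  simp only [h3, mul_neg, integral_neg, neg_inj] at h4
  rw [h2, h4, moll]

theorem ae_tendsto_moll {v : E3 → ℝ} (hv : LocallyIntegrable v volume) :
    ∀ᵐ x, Tendsto (fun k => moll k v x) atTop (𝓝 (v x)) := by
  have h := ContDiffBump.ae_convolution_tendsto_right_of_locallyIntegrable (μ := volume)
    (φ := bump) (l := atTop) (K := 2) tendsto_bump_rOut ?_ hv
  · filter_upwards [h] with x hx
    simpa only [moll_eq_convolution', mollKernel] using hx
  · refine Eventually.of_forall fun k => ?_
    change 1 / ((k : ℝ) + 1) ≤ 2 * (1 / (2 * ((k : ℝ) + 1)))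
    apply le_of_eq
    field_simp

/-- Mollification is a contraction of `L^2`, in dual form. Swapping the integrals reduces it to
Hölder's inequality for `w` and a translate of `g`. -/
theorem lintegral_enorm_mul_moll_le (k : ℕ) {w g : E3 → ℝ} (hw : AEStronglyMeasurable w volume)
    (hg : AEStronglyMeasurable g volume) :
    ∫⁻ x, ‖w x * moll k g x‖ₑ ≤ eLpNorm w 2 volume * eLpNorm g 2 volume := by
  have hφm : Measurable (mollKernel k) := (contDiff_mollKernel k).continuous.measurable
  have hgsub : ∀ y, AEStronglyMeasurable (fun x => g (x - y)) volume := fun y =>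
    hg.comp_measurePreserving (measurePreserving_sub_right volume y)
  have hholder : ∀ y, ∫⁻ x, ‖w x‖ₑ * ‖g (x - y)‖ₑ ≤ eLpNorm w 2 volume * eLpNorm g 2 volume := by
    intro y
    have h := eLpNorm_smul_le_mul_eLpNorm (p := 2) (q := 2) (r := 1) (hgsub y) hw
    rw [eLpNorm_one_eq_lintegral_enorm] at h
    have h2 : eLpNorm (fun x => g (x - y)) 2 volume = eLpNorm g 2 volume :=
      eLpNorm_comp_measurePreserving hg (measurePreserving_sub_right volume y)
    rw [h2] at h
    simpa [enorm_mul] using h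
  have hmeas : AEMeasurable
      (Function.uncurry fun x y : E3 => ‖w x‖ₑ * (‖mollKernel k y‖ₑ * ‖g (x - y)‖ₑ))
      (volume.prod volume) := by
    refine (hw.comp_fst.enorm).mul ((hφm.comp measurable_snd).enorm.aemeasurable.mul ?_)
    exact (hg.comp_quasiMeasurePreserving
      (quasiMeasurePreserving_sub_of_right_invariant volume volume)).enorm
  calc ∫⁻ x, ‖w x * moll k g x‖ₑ
      ≤ ∫⁻ x, ∫⁻ y, ‖w x‖ₑ * (‖mollKernel k y‖ₑ * ‖g (x - y)‖ₑ) := by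
        refine lintegral_mono fun x => ?_
        rw [enorm_mul, moll_eq_integral_swap, lintegral_const_mul' _ _ enorm_ne_top]
        gcongr
        refine (enorm_integral_le_lintegral_enorm _).trans_eq ?_
        simp [enorm_mul]
    _ = ∫⁻ y, ∫⁻ x, ‖w x‖ₑ * (‖mollKernel k y‖ₑ * ‖g (x - y)‖ₑ) := lintegral_lintegral_swap hmeas
    _ = ∫⁻ y, ‖mollKernel k y‖ₑ * ∫⁻ x, ‖w x‖ₑ * ‖g (x - y)‖ₑ := by
        refine lintegral_congr fun y => ?_
        rw [← lintegral_const_mul' _ _ enorm_ne_top]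
        refine lintegral_congr fun x => ?_
        ring
    _ ≤ ∫⁻ y, ‖mollKernel k y‖ₑ * (eLpNorm w 2 volume * eLpNorm g 2 volume) := by
        gcongr with y
        exact hholder y
    _ = eLpNorm w 2 volume * eLpNorm g 2 volume := by
        rw [lintegral_mul_const'' _ hφm.enorm.aemeasurable]
        have h1 : ∫⁻ y, ‖mollKernel k y‖ₑ = 1 := by
          have h2 := ofReal_integral_eq_lintegral_ofReal (integrable_mollKernel k)
            (ae_of_all _ (mollKernel_nonneg k))
          rw [integral_mollKernel, ENNReal.ofReal_one] at h2
          rw [h2]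
          refine lintegral_congr fun y => ?_
          rw [Real.enorm_of_nonneg (mollKernel_nonneg k y)]
        rw [h1, one_mul]

theorem integrable_mul_moll (k : ℕ) {w g : E3 → ℝ} (hw : MemLp w 2 volume)
    (hg : MemLp g 2 volume) : Integrable (fun x => w x * moll k g x) volume := by
  refine ⟨hw.aestronglyMeasurable.mul (contDiff_moll k
    (hg.locallyIntegrable (by norm_num))).continuous.aestronglyMeasurable, ?_⟩
  exact (lintegral_enorm_mul_moll_le k hw.aestronglyMeasurable hg.aestronglyMeasurable).trans_lt
    (ENNReal.mul_lt_top hw.eLpNorm_lt_top hg.eLpNorm_lt_top)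

theorem tendsto_integral_mul_moll_of_continuous {w g : E3 → ℝ} (hw : Integrable w volume)
    (hg : Continuous g) (hgs : HasCompactSupport g) :
    Tendsto (fun k => ∫ x, w x * moll k g x) atTop (𝓝 (∫ x, w x * g x)) := by
  obtain ⟨C, hC⟩ := hgs.exists_bound_of_continuous hg
  refine tendsto_integral_of_dominated_convergence (fun x => ‖w x‖ * C) ?_ (hw.norm.mul_const C)
    ?_ ?_
  · exact fun k => hw.aestronglyMeasurable.mul
      (contDiff_moll k hg.locallyIntegrable).continuous.aestronglyMeasurable
  · refine fun k => ae_of_all _ fun x => ?_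
    rw [norm_mul]
    exact mul_le_mul_of_nonneg_left (abs_moll_le (ae_of_all _ fun t _ => hC t)) (norm_nonneg _)
  · refine ae_of_all _ fun x => ?_
    have h := ContDiffBump.convolution_tendsto_right_of_continuous (μ := volume)
      (φ := bump) tendsto_bump_rOut hg x
    refine Tendsto.const_mul _ ?_
    simpa only [moll_eq_convolution', mollKernel] using h

theorem tendsto_integral_mul_moll_of_memLp {w g : E3 → ℝ} (hw : MemLp w 2 volume)
    (hwi : Integrable w volume) (hg : MemLp g 2 volume) :
    Tendsto (fun k => ∫ x, w x * moll k g x) atTop (𝓝 (∫ x, w x * g x)) := by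
  rw [Metric.tendsto_atTop]
  intro δ hδ
  set W := (eLpNorm w 2 volume).toReal
  have hW : 0 ≤ W := ENNReal.toReal_nonneg
  set τ := δ / (3 * (W + 1))
  have hτ : 0 < τ := by positivity
  obtain ⟨f, hfs, hfc, hfn⟩ := hg.exist_eLpNorm_sub_le (by simp) (by norm_num) hτ
  have hf2 : MemLp f 2 volume := hfc.continuous.memLp_of_hasCompactSupport hfs
  have hgf : MemLp (fun x => g x - f x) 2 volume := hg.sub hf2
  have hfn' : (eLpNorm (fun x => g x - f x) 2 volume).toReal ≤ τ :=
    ENNReal.toReal_le_of_le_ofReal hτ.le hfn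
  have hWτ : W * (eLpNorm (fun x => g x - f x) 2 volume).toReal < δ / 3 := by
    calc W * (eLpNorm (fun x => g x - f x) 2 volume).toReal ≤ W * τ := by gcongr
      _ < (W + 1) * τ := by linarith
      _ = δ / 3 := by simp only [τ]; field_simp
  have hgl : LocallyIntegrable g volume := hg.locallyIntegrable (by norm_num)
  have hfl : LocallyIntegrable f volume := hf2.locallyIntegrable (by norm_num)
  have htop : eLpNorm w 2 volume * eLpNorm (fun x => g x - f x) 2 volume ≠ ⊤ :=
    ENNReal.mul_ne_top hw.eLpNorm_ne_top hgf.eLpNorm_ne_top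
  -- both error terms `∫ w φ_k * (g - f)` and `∫ w (g - f)` are small, by the `L^2` bound
  have hA : ∀ k, |∫ x, w x * moll k (fun y => g y - f y) x| < δ / 3 := by
    intro k
    have h := ENNReal.toReal_mono htop
      ((enorm_integral_le_lintegral_enorm _).trans
        (lintegral_enorm_mul_moll_le k hw.aestronglyMeasurable hgf.aestronglyMeasurable))
    rw [ENNReal.toReal_mul, toReal_enorm] at h
    exact lt_of_le_of_lt h hWτ
  have hB : |∫ x, w x * (g x - f x)| < δ / 3 := by
    have h0 : ‖∫ x, w x * (g x - f x)‖ₑ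
        ≤ eLpNorm w 2 volume * eLpNorm (fun x => g x - f x) 2 volume := by
      refine (enorm_integral_le_lintegral_enorm _).trans ?_
      have h := eLpNorm_smul_le_mul_eLpNorm (p := 2) (q := 2) (r := 1)
        hgf.aestronglyMeasurable hw.aestronglyMeasurable
      rw [eLpNorm_one_eq_lintegral_enorm] at h
      exact h
    have h := ENNReal.toReal_mono htop h0
    rw [ENNReal.toReal_mul, toReal_enorm] at h
    exact lt_of_le_of_lt h hWτ
  obtain ⟨N, hN⟩ := Metric.tendsto_atTop.1
    (tendsto_integral_mul_moll_of_continuous hwi hfc.continuous hfs) (δ / 3) (by positivity)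
  refine ⟨N, fun k hk => ?_⟩
  have e1 : ∫ x, w x * moll k (fun y => g y - f y) x
      = (∫ x, w x * moll k g x) - ∫ x, w x * moll k f x := by
    rw [← integral_sub (integrable_mul_moll k hw hg) (integrable_mul_moll k hw hf2)]
    refine integral_congr_ae (ae_of_all _ fun x => ?_)
    simp only [moll_sub k hgl hfl]
    ring
  have e2 : ∫ x, w x * (g x - f x) = (∫ x, w x * g x) - ∫ x, w x * f x := by
    have i1 : Integrable (fun x => w x * g x) volume := hw.integrable_mul hg
    have i2 : Integrable (fun x => w x * f x) volume := hw.integrable_mul hf2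
    rw [← integral_sub i1 i2]
    refine integral_congr_ae (ae_of_all _ fun x => ?_)
    ring
  have h1 := abs_lt.1 (hA k)
  have h2 := abs_lt.1 hB
  have h3 := abs_lt.1 (Real.dist_eq _ _ ▸ hN k hk)
  rw [e1] at h1
  rw [e2] at h2
  rw [Real.dist_eq, abs_lt]
  constructor <;> linarith [h1.1, h1.2, h2.1, h2.2, h3.1, h3.2]

/-- Weak `L^2_loc` convergence of mollifications. -/
theorem tendsto_integral_mul_moll {w g : E3 → ℝ} {R : ℝ} (hw : MemLp w 2 volume)
    (hR : ∀ x, R < ‖x‖ → w x = 0) (hg : MemL2loc g) :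
    Tendsto (fun k => ∫ x, w x * moll k g x) atTop (𝓝 (∫ x, w x * g x)) := by
  have hwi : Integrable w volume := by
    have hK := isCompact_closedBall (0 : E3) R
    have : IsFiniteMeasure (volume.restrict (Metric.closedBall (0 : E3) R)) :=
      ⟨by simpa using hK.measure_lt_top (μ := volume)⟩
    refine (integrableOn_iff_integrable_of_support_subset (s := Metric.closedBall 0 R) ?_).1
      ((hw.restrict _).integrable (by norm_num))
    intro x hx
    rw [mem_closedBall_zero_iff]
    by_contra h
    exact hx (hR x (not_le.1 h))
  -- on the ball of radius `R` the mollifications only see `g` on the ball of radius `R + 1`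
  set B := Metric.closedBall (0 : E3) (R + 1)
  have hgB : MemLp (B.indicator g) 2 volume :=
    (memLp_indicator_iff_restrict Metric.isClosed_closedBall.measurableSet).2
      (hg B (isCompact_closedBall _ _))
  have h := tendsto_integral_mul_moll_of_memLp hw hwi hgB
  have e1 : ∀ k, ∫ x, w x * moll k (B.indicator g) x = ∫ x, w x * moll k g x := by
    intro k
    refine integral_congr_ae (ae_of_all _ fun x => ?_)
    rcases lt_or_ge R ‖x‖ with hx | hx
    · simp [hR x hx]
    · simp only
      rw [moll_congr_near fun t ht => ?_]
      refine indicator_of_mem ?_ g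
      rw [mem_closedBall_zero_iff]
      have := norm_sub_norm_le t x
      rw [norm_sub_rev] at this
      linarith
  have e2 : ∫ x, w x * B.indicator g x = ∫ x, w x * g x := by
    refine integral_congr_ae (ae_of_all _ fun x => ?_)
    rcases lt_or_ge R ‖x‖ with hx | hx
    · simp [hR x hx]
    · have : x ∈ B := by
        rw [mem_closedBall_zero_iff]
        linarith
      simp [this]
  simpa only [e1, e2] using h

/-! ### The Caccioppoli inequality -/

/-- A divergence-free flux `q` may be tested with `η² v` for every `v` in `H^1_loc`: the
mollifications of `v` provide admissible test functions, and they converge weakly. -/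
theorem integral_flux_eq_zero {q : Fin 3 → E3 → ℝ} (hq : ∀ i, MemL2loc (q i))
    {v : E3 → ℝ} {g : Fin 3 → E3 → ℝ} (hv : IsWeakGrad v g)
    {η : E3 → ℝ} (hη : ContDiff ℝ ∞ η) (hηs : HasCompactSupport η)
    (heq : ∀ ψ : E3 → ℝ, ContDiff ℝ ∞ ψ → HasCompactSupport ψ → tsupport ψ ⊆ tsupport η →
      ∫ x, ∑ i, q i x * pd i ψ x = 0) :
    ∫ x, ∑ i, (η x ^ 2 * (q i x * g i x) + 2 * η x * pd i η x * (q i x * v x)) = 0 := by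
  have hvl := hv.memL2loc.locallyIntegrable
  have ha : Continuous fun x => η x ^ 2 := hη.continuous.pow 2
  have has : HasCompactSupport fun x => η x ^ 2 := hηs.comp_left (g := fun t : ℝ => t ^ 2) (by simp)
  have hb : ∀ i, Continuous fun x => 2 * η x * pd i η x := fun i =>
    (continuous_const.mul hη.continuous).mul (contDiff_pd hη i).continuous
  have hbs : ∀ i, HasCompactSupport fun x => 2 * η x * pd i η x := fun i =>
    (hasCompactSupport_pd hηs i).mul_left (f := fun x => 2 * η x)
  -- the equation tested with `η²` times the `k`-th mollification of `v`
  have hvanish : ∀ k, ∑ i, ((∫ x, η x ^ 2 * q i x * moll k (g i) x)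
      + ∫ x, 2 * η x * pd i η x * q i x * moll k v x) = 0 := by
    intro k
    have hm := contDiff_moll k hvl
    have hψ : ContDiff ℝ ∞ fun x => η x ^ 2 * moll k v x := (hη.pow 2).mul hm
    have hψs : HasCompactSupport fun x => η x ^ 2 * moll k v x := has.mul_right
    have hsub : tsupport (fun x => η x ^ 2 * moll k v x) ⊆ tsupport η := by
      refine closure_mono fun x hx h0 => hx ?_
      simp [h0]
    have h := heq _ hψ hψs hsub
    rw [← h, integral_finsetSum]
    · refine Finset.sum_congr rfl fun i _ => ?_
      have hmg : Continuous (moll k (g i)) :=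
        (contDiff_moll k (hv.memL2loc_grad i).locallyIntegrable).continuous
      have i1 : Integrable fun x => η x ^ 2 * q i x * moll k (g i) x := by
        have := MemL2loc.integrable_mul (ha.mul hmg) has.mul_right (hq i)
        refine this.congr (ae_of_all _ fun x => ?_)
        simp only [Pi.mul_apply]; ring
      have i2 : Integrable fun x => 2 * η x * pd i η x * q i x * moll k v x := by
        have := MemL2loc.integrable_mul ((hb i).mul hm.continuous) (hbs i).mul_right (hq i)
        refine this.congr (ae_of_all _ fun x => ?_)
        simp only [Pi.mul_apply]; ring
      rw [← integral_add i1 i2]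
      refine integral_congr_ae (ae_of_all _ fun x => ?_)
      have e1 := pd_mul (hη.pow 2) hm i x
      have e2 : pd i (fun x => η x ^ 2) x = 2 * η x * pd i η x := by
        simp only [pow_two]
        rw [pd_mul hη hη]; ring
      have e3 : pd i (moll k v) x = moll k (g i) x := congrFun (pd_moll k (hv.hasWeakPartial i)) x
      rw [e3, e2] at e1
      simp only [e1]
      ring
    · intro i _
      exact MemL2loc.integrable_mul (contDiff_pd hψ i).continuous
        (hasCompactSupport_pd hψs i) (hq i)
  obtain ⟨R, hR⟩ := hηs.isBounded.subset_closedBall (0 : E3)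
  have hη0 : ∀ x : E3, R < ‖x‖ → η x = 0 := fun x hx => by
    refine image_eq_zero_of_notMem_tsupport fun h => ?_
    have := mem_closedBall_zero_iff.1 (hR h)
    linarith
  have hlim : Tendsto (fun k => ∑ i, ((∫ x, η x ^ 2 * q i x * moll k (g i) x)
      + ∫ x, 2 * η x * pd i η x * q i x * moll k v x)) atTop
      (𝓝 (∑ i, ((∫ x, η x ^ 2 * q i x * g i x) + ∫ x, 2 * η x * pd i η x * q i x * v x))) := by
    refine tendsto_finsetSum _ fun i _ => Tendsto.add ?_ ?_
    · exact tendsto_integral_mul_moll (R := R) (MemL2loc.memLp_continuous_mul ha has (hq i))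
        (fun x hx => by simp [hη0 x hx]) (hv.memL2loc_grad i)
    · exact tendsto_integral_mul_moll (R := R) (MemL2loc.memLp_continuous_mul (hb i) (hbs i) (hq i))
        (fun x hx => by simp [hη0 x hx]) hv.memL2loc
  simp only [hvanish] at hlim
  have h0 := tendsto_nhds_unique hlim tendsto_const_nhds
  have j1 : ∀ i, Integrable fun x => η x ^ 2 * (q i x * g i x) := fun i =>
    MemL2loc.integrable_mul_mul ha has (hq i) (hv.memL2loc_grad i)
  have j2 : ∀ i, Integrable fun x => 2 * η x * pd i η x * (q i x * v x) := fun i =>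
    MemL2loc.integrable_mul_mul (hb i) (hbs i) (hq i) hv.memL2loc
  have j3 : ∀ i, Integrable fun x =>
      η x ^ 2 * (q i x * g i x) + 2 * η x * pd i η x * (q i x * v x) := fun i => (j1 i).add (j2 i)
  rw [integral_finsetSum _ fun i _ => j3 i, ← h0]
  refine Finset.sum_congr rfl fun i _ => ?_
  rw [integral_add (j1 i) (j2 i)]
  simp only [mul_assoc]

/-- Young's inequality for one entry of the cross term. -/
theorem neg_two_mul_le_of_abs_le {c M a p q : ℝ} (hc : 0 < c) (ha : |a| ≤ M) :
    -(2 * a * p * q) ≤ c / 6 * p ^ 2 + 6 * M ^ 2 / c * q ^ 2 := by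
  have h1 : a ^ 2 ≤ M ^ 2 := sq_le_sq' (abs_le.1 ha).1 (abs_le.1 ha).2
  have h2 : 6 * a ^ 2 / c * q ^ 2 ≤ 6 * M ^ 2 / c * q ^ 2 := by gcongr
  have h3 : c / 6 * p ^ 2 + 2 * a * p * q + 6 * a ^ 2 / c * q ^ 2
      = c / 6 * (p + 6 / c * a * q) ^ 2 := by
    field_simp
    ring
  have h4 : 0 ≤ c / 6 * (p + 6 / c * a * q) ^ 2 := by positivity
  linarith

/-- The algebraic heart of the Caccioppoli inequality: after testing with `η² v`, the cross term
is absorbed into half of the elliptic term. -/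
theorem caccioppoli_pointwise {A : Matrix (Fin 3) (Fin 3) ℝ} {M c : ℝ} (hM : ∀ i j, |A i j| ≤ M)
    (hc : 0 < c) (hell : ∀ ξ : Fin 3 → ℝ, c * (ξ ⬝ᵥ ξ) ≤ ξ ⬝ᵥ (A *ᵥ ξ))
    (g d : Fin 3 → ℝ) (η v : ℝ) :
    c / 2 * (η ^ 2 * ∑ i, g i ^ 2) ≤
      (∑ i, (η ^ 2 * ((A *ᵥ g) i * g i) + 2 * η * d i * ((A *ᵥ g) i * v)))
        + 18 * M ^ 2 / c * (v ^ 2 * ∑ i, d i ^ 2) := by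
  have h1 : η ^ 2 * (c * (g ⬝ᵥ g)) ≤ η ^ 2 * (g ⬝ᵥ (A *ᵥ g)) :=
    mul_le_mul_of_nonneg_left (hell g) (sq_nonneg η)
  have h2 : ∑ i, ∑ j, -(2 * A i j * (η * g j) * (v * d i))
      ≤ ∑ i, ∑ j, (c / 6 * (η * g j) ^ 2 + 6 * M ^ 2 / c * (v * d i) ^ 2) :=
    Finset.sum_le_sum fun i _ => Finset.sum_le_sum fun j _ =>
      neg_two_mul_le_of_abs_le hc (hM i j)
  simp only [dotProduct, Matrix.mulVec, Fin.sum_univ_three] at h1 h2 ⊢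
  generalize hK : M ^ 2 / c = K at *
  have e6 : 6 * M ^ 2 / c = 6 * K := by rw [← hK]; ring
  have e18 : 18 * M ^ 2 / c = 18 * K := by rw [← hK]; ring
  rw [e6] at h2
  rw [e18]
  linarith

/-- The **Caccioppoli inequality** for a weak solution of `∇·(A∇v) = 0` near the support
of `η`. -/
theorem caccioppoli {A : E3 → Matrix (Fin 3) (Fin 3) ℝ} {M c : ℝ}
    (hA : ∀ i j, Measurable fun x => A x i j) (hM : ∀ x i j, |A x i j| ≤ M) (hc : 0 < c)
    (hell : ∀ (x : E3) (ξ : Fin 3 → ℝ), c * (ξ ⬝ᵥ ξ) ≤ ξ ⬝ᵥ (A x *ᵥ ξ))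
    {v : E3 → ℝ} {g : Fin 3 → E3 → ℝ} (hv : IsWeakGrad v g)
    {η : E3 → ℝ} (hη : ContDiff ℝ ∞ η) (hηs : HasCompactSupport η)
    (heq : ∀ ψ : E3 → ℝ, ContDiff ℝ ∞ ψ → HasCompactSupport ψ → tsupport ψ ⊆ tsupport η →
      ∫ x, ∑ i, (A x *ᵥ fun j => g j x) i * pd i ψ x = 0) :
    ∫ x, η x ^ 2 * ∑ i, g i x ^ 2 ≤
      36 * M ^ 2 / c ^ 2 * ∫ x, v x ^ 2 * ∑ i, pd i η x ^ 2 := by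
  have hq : ∀ i, MemL2loc fun x => (A x *ᵥ fun j => g j x) i := fun i =>
    MemL2loc.sum fun j => MemL2loc.bdd_mul (hA i j) (fun x => hM x i j) (hv.memL2loc_grad j)
  have h0 := integral_flux_eq_zero hq hv hη hηs heq
  have ha : Continuous fun x => η x ^ 2 := hη.continuous.pow 2
  have has : HasCompactSupport fun x => η x ^ 2 := hηs.comp_left (g := fun t : ℝ => t ^ 2) (by simp)
  have hb : ∀ i, Continuous fun x => 2 * η x * pd i η x := fun i =>
    (continuous_const.mul hη.continuous).mul (contDiff_pd hη i).continuous
  have hbs : ∀ i, HasCompactSupport fun x => 2 * η x * pd i η x := fun i =>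
    (hasCompactSupport_pd hηs i).mul_left (f := fun x => 2 * η x)
  have i1 : Integrable fun x => η x ^ 2 * ∑ i, g i x ^ 2 := by
    simp only [Finset.mul_sum, pow_two (g _ _)]
    exact integrable_finsetSum _ fun i _ =>
      MemL2loc.integrable_mul_mul ha has (hv.memL2loc_grad i) (hv.memL2loc_grad i)
  have i2 : Integrable fun x => ∑ i, (η x ^ 2 * ((A x *ᵥ fun j => g j x) i * g i x)
      + 2 * η x * pd i η x * ((A x *ᵥ fun j => g j x) i * v x)) := by
    refine integrable_finsetSum _ fun i _ => ?_
    have j1 := MemL2loc.integrable_mul_mul ha has (hq i) (hv.memL2loc_grad i)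
    have j2 := MemL2loc.integrable_mul_mul (hb i) (hbs i) (hq i) hv.memL2loc
    exact j1.add j2
  have i3 : Integrable fun x => v x ^ 2 * ∑ i, pd i η x ^ 2 := by
    simp only [Finset.mul_sum, pow_two (v _)]
    refine integrable_finsetSum _ fun i _ => ?_
    have hd : Continuous fun x => pd i η x ^ 2 := (contDiff_pd hη i).continuous.pow 2
    have hds : HasCompactSupport fun x => pd i η x ^ 2 :=
      HasCompactSupport.comp_left (f := pd i η) (hasCompactSupport_pd hηs i)
        (g := fun t : ℝ => t ^ 2) (by simp)
    refine (MemL2loc.integrable_mul_mul hd hds hv.memL2loc hv.memL2loc).congr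
      (ae_of_all _ fun x => ?_)
    ring
  have hint : ∫ x, c / 2 * (η x ^ 2 * ∑ i, g i x ^ 2) ≤
      ∫ x, ((∑ i, (η x ^ 2 * ((A x *ᵥ fun j => g j x) i * g i x)
      + 2 * η x * pd i η x * ((A x *ᵥ fun j => g j x) i * v x)))
        + 18 * M ^ 2 / c * (v x ^ 2 * ∑ i, pd i η x ^ 2)) :=
    integral_mono (i1.const_mul _) (i2.add (i3.const_mul _)) fun x =>
      caccioppoli_pointwise (hM x) hc (hell x) (fun j => g j x) (fun i => pd i η x) (η x) (v x)
  rw [integral_add i2 (i3.const_mul _), h0, zero_add, integral_const_mul, integral_const_mul]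
    at hint
  have h2 : 36 * M ^ 2 / c ^ 2 * (∫ x, v x ^ 2 * ∑ i, pd i η x ^ 2)
      = 2 / c * (18 * M ^ 2 / c * ∫ x, v x ^ 2 * ∑ i, pd i η x ^ 2) := by
    field_simp
    ring
  rw [h2]
  calc ∫ x, η x ^ 2 * ∑ i, g i x ^ 2 = 2 / c * (c / 2 * ∫ x, η x ^ 2 * ∑ i, g i x ^ 2) := by
        field_simp
    _ ≤ _ := by gcongr

/-! ### Cutoff functions -/

/-- A fixed smooth bump, equal to `1` on the unit ball and supported in the ball of radius `2`. -/
noncomputable def unitCutoff : ContDiffBump (0 : E3) where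
  rIn := 1
  rOut := 2
  rIn_pos := one_pos
  rIn_lt_rOut := one_lt_two

/-- The cutoff at scale `R`: equal to `1` for `‖x‖ ≤ R`, and to `0` for `2 R ≤ ‖x‖`. -/
noncomputable def cutoff (R : ℝ) : E3 → ℝ := fun x => unitCutoff (R⁻¹ • x)

theorem contDiff_cutoff (R : ℝ) : ContDiff ℝ ∞ (cutoff R) :=
  unitCutoff.contDiff.comp (contDiff_const_smul R⁻¹)

theorem cutoff_eq_one {R : ℝ} (hR : 0 < R) {x : E3} (hx : ‖x‖ ≤ R) : cutoff R x = 1 := by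
  apply unitCutoff.one_of_mem_closedBall
  rw [mem_closedBall_zero_iff, norm_smul, norm_inv, Real.norm_of_nonneg hR.le,
    inv_mul_le_iff₀ hR]
  change ‖x‖ ≤ R * 1
  linarith

theorem cutoff_eq_zero {R : ℝ} (hR : 0 < R) {x : E3} (hx : 2 * R ≤ ‖x‖) : cutoff R x = 0 := by
  apply unitCutoff.zero_of_le_dist
  rw [dist_zero_right, norm_smul, norm_inv, Real.norm_of_nonneg hR.le, le_inv_mul_iff₀ hR]
  change R * 2 ≤ ‖x‖
  linarith

theorem hasCompactSupport_cutoff {R : ℝ} (hR : 0 < R) : HasCompactSupport (cutoff R) :=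
  HasCompactSupport.intro (isCompact_closedBall 0 (2 * R)) fun x hx =>
    cutoff_eq_zero hR (by rw [mem_closedBall_zero_iff, not_le] at hx; exact hx.le)

theorem pd_eq_zero_of_eq_const {ψ : E3 → ℝ} {s : Set E3} (hs : IsOpen s) {c : ℝ}
    (h : ∀ x ∈ s, ψ x = c) (i : Fin 3) {x : E3} (hx : x ∈ s) : pd i ψ x = 0 := by
  have : ψ =ᶠ[𝓝 x] fun _ => c := by
    filter_upwards [hs.mem_nhds hx] with y hy using h y hy
  simp only [pd]
  rw [this.fderiv_eq]
  simp

theorem pd_cutoff_eq_zero_of_lt {R : ℝ} (hR : 0 < R) {x : E3} (hx : ‖x‖ < R) (i : Fin 3) :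
    pd i (cutoff R) x = 0 :=
  pd_eq_zero_of_eq_const (isOpen_lt continuous_norm continuous_const) (c := 1)
    (fun _ hy => cutoff_eq_one hR (le_of_lt hy)) i hx

theorem pd_cutoff_eq_zero_of_gt {R : ℝ} (hR : 0 < R) {x : E3} (hx : 2 * R < ‖x‖) (i : Fin 3) :
    pd i (cutoff R) x = 0 :=
  pd_eq_zero_of_eq_const (isOpen_lt continuous_const continuous_norm) (c := 0)
    (fun _ hy => cutoff_eq_zero hR (le_of_lt hy)) i hx

theorem exists_abs_pd_cutoff_le :
    ∃ B : ℝ, 0 ≤ B ∧ ∀ R : ℝ, 0 < R → ∀ i x, |pd i (cutoff R) x| ≤ B / R := by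
  obtain ⟨B, hB⟩ := (unitCutoff.hasCompactSupport.fderiv ℝ).exists_bound_of_continuous
    (unitCutoff.contDiff.continuous_fderiv (n := 1) (by simp))
  refine ⟨B, (norm_nonneg _).trans (hB 0), fun R hR i x => ?_⟩
  have hd : DifferentiableAt ℝ unitCutoff (R⁻¹ • x) :=
    (unitCutoff.contDiff (n := 1)).differentiable (by simp) _
  have hc := hd.hasFDerivAt.comp x ((hasFDerivAt_id x).const_smul R⁻¹)
  have hc' : fderiv ℝ (cutoff R) x = _ := hc.fderiv
  simp only [pd]
  rw [hc']
  have h1 : ‖(fderiv ℝ unitCutoff (R⁻¹ • x)) (R⁻¹ • EuclideanSpace.single i (1 : ℝ))‖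
      ≤ B * (R⁻¹ * 1) := by
    refine (ContinuousLinearMap.le_opNorm _ _).trans ?_
    refine mul_le_mul (hB _) ?_ (norm_nonneg _) ((norm_nonneg _).trans (hB 0))
    rw [norm_smul, norm_inv, Real.norm_of_nonneg hR.le, PiLp.norm_single, norm_one]
  simpa [div_eq_mul_inv] using h1

/-- The closed annulus of radii `R` and `2 R`. -/
def annulus (R : ℝ) : Set E3 := {x | R ≤ ‖x‖ ∧ ‖x‖ ≤ 2 * R}

theorem isCompact_annulus (R : ℝ) : IsCompact (annulus R) := by
  refine (isCompact_closedBall (0 : E3) (2 * R)).of_isClosed_subset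
    ((isClosed_le continuous_const continuous_norm).inter
      (isClosed_le continuous_norm continuous_const)) fun x hx => ?_
  rw [mem_closedBall_zero_iff]
  exact hx.2

/-! ### Growth estimates and a Liouville theorem -/

/-- A **Liouville theorem**: an entire weak solution of `∇·(A∇v) = 0` whose square integral over
the annulus of radius `R` grows at most linearly has zero gradient. The Caccioppoli inequality
bounds the Dirichlet integral over a fixed ball by `O(R^{-2}) O(R)`. -/
theorem ae_grad_eq_zero_of_growth {A : E3 → Matrix (Fin 3) (Fin 3) ℝ} {M c : ℝ}
    (hA : ∀ i j, Measurable fun x => A x i j) (hM : ∀ x i j, |A x i j| ≤ M) (hc : 0 < c)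
    (hell : ∀ (x : E3) (ξ : Fin 3 → ℝ), c * (ξ ⬝ᵥ ξ) ≤ ξ ⬝ᵥ (A x *ᵥ ξ))
    {v : E3 → ℝ} {g : Fin 3 → E3 → ℝ} (hv : IsWeakGrad v g)
    (heq : ∀ ψ : E3 → ℝ, ContDiff ℝ ∞ ψ → HasCompactSupport ψ →
      ∫ x, ∑ i, (A x *ᵥ fun j => g j x) i * pd i ψ x = 0)
    {C R₀ : ℝ} (hgrowth : ∀ R, R₀ ≤ R → ∫ x in annulus R, v x ^ 2 ≤ C * R) :
    ∀ᵐ x, ∀ i, g i x = 0 := by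
  obtain ⟨B, hB0, hB⟩ := exists_abs_pd_cutoff_le
  set K : ℝ := 36 * M ^ 2 / c ^ 2
  have hK : 0 ≤ K := by positivity
  have hcutoff : ∀ R, R₀ ≤ R → 0 < R →
      ∫ x, cutoff R x ^ 2 * ∑ i, g i x ^ 2 ≤ K * (3 * B ^ 2 * C) / R := by
    intro R hR hRpos
    have h1 := caccioppoli hA hM hc hell hv (contDiff_cutoff R) (hasCompactSupport_cutoff hRpos)
      fun ψ h1 h2 _ => heq ψ h1 h2
    have hint : Integrable ((annulus R).indicator fun x => 3 * (B / R) ^ 2 * v x ^ 2) :=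
      (integrable_indicator_iff (isCompact_annulus R).measurableSet).2
        ((hv.memL2loc.integrableOn_sq (isCompact_annulus R)).const_mul _)
    have h2 : ∫ x, v x ^ 2 * ∑ i, pd i (cutoff R) x ^ 2
        ≤ ∫ x, (annulus R).indicator (fun x => 3 * (B / R) ^ 2 * v x ^ 2) x := by
      refine integral_mono_of_nonneg (ae_of_all _ fun x => by positivity) hint
        (ae_of_all _ fun x => ?_)
      by_cases hx : x ∈ annulus R
      · simp only [indicator_of_mem hx, Fin.sum_univ_three]
        have hsq : ∀ i, pd i (cutoff R) x ^ 2 ≤ (B / R) ^ 2 := fun i =>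
          sq_le_sq' (abs_le.1 (hB R hRpos i x)).1 (abs_le.1 (hB R hRpos i x)).2
        nlinarith [hsq 0, hsq 1, hsq 2, sq_nonneg (v x)]
      · simp only [indicator_of_notMem hx]
        have h0 : ∀ i, pd i (cutoff R) x = 0 := by
          intro i
          rcases lt_or_ge ‖x‖ R with h | h
          · exact pd_cutoff_eq_zero_of_lt hRpos h i
          · refine pd_cutoff_eq_zero_of_gt hRpos (lt_of_not_ge fun h' => hx ⟨h, h'⟩) i
        have hz : v x ^ 2 * ∑ i, pd i (cutoff R) x ^ 2 = 0 := by
          simp only [h0]; simp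
        exact hz.le
    rw [integral_indicator (isCompact_annulus R).measurableSet, integral_const_mul] at h2
    calc _ ≤ K * ∫ x, v x ^ 2 * ∑ i, pd i (cutoff R) x ^ 2 := h1
      _ ≤ K * (3 * (B / R) ^ 2 * (C * R)) := by
          gcongr
          refine h2.trans ?_
          gcongr
          exact hgrowth R hR
      _ = _ := by field_simp
  have hgi : ∀ s : Set E3, IsCompact s → IntegrableOn (fun x => ∑ i, g i x ^ 2) s := fun s hs =>
    integrable_finsetSum _ fun i _ => (hv.memL2loc_grad i).integrableOn_sq hs
  have hball : ∀ n : ℕ, ∀ᵐ x, x ∈ Metric.closedBall (0 : E3) n → ∑ i, g i x ^ 2 = 0 := by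
    intro n
    have hcomp := isCompact_closedBall (0 : E3) n
    have hle : ∀ᶠ R : ℝ in atTop, ∫ x in Metric.closedBall (0 : E3) n, ∑ i, g i x ^ 2
        ≤ K * (3 * B ^ 2 * C) / R := by
      filter_upwards [eventually_ge_atTop R₀, eventually_gt_atTop 0,
        eventually_ge_atTop (n : ℝ)] with R h1 h2 h3
      refine le_trans ?_ (hcutoff R h1 h2)
      rw [← integral_indicator hcomp.measurableSet]
      refine integral_mono_of_nonneg (ae_of_all _ fun x => ?_) ?_ (ae_of_all _ fun x => ?_)
      · exact indicator_nonneg (fun _ _ => Finset.sum_nonneg fun _ _ => sq_nonneg _) x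
      · simp only [Finset.mul_sum, pow_two (g _ _)]
        exact integrable_finsetSum _ fun i _ =>
          MemL2loc.integrable_mul_mul ((contDiff_cutoff R).continuous.pow 2)
            ((hasCompactSupport_cutoff h2).comp_left (g := fun t : ℝ => t ^ 2) (by simp))
            (hv.memL2loc_grad i) (hv.memL2loc_grad i)
      · by_cases hx : x ∈ Metric.closedBall (0 : E3) n
        · rw [indicator_of_mem hx]
          rw [mem_closedBall_zero_iff] at hx
          simp only [cutoff_eq_one h2 (hx.trans h3)]
          simp
        · rw [indicator_of_notMem hx]
          positivity
    have hlim : Tendsto (fun R : ℝ => K * (3 * B ^ 2 * C) / R) atTop (𝓝 0) :=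
      tendsto_const_nhds.div_atTop tendsto_id
    have h0 := ge_of_tendsto hlim hle
    have hnn : 0 ≤ᵐ[volume.restrict (Metric.closedBall (0 : E3) n)] fun x => ∑ i, g i x ^ 2 :=
      ae_of_all _ fun x => Finset.sum_nonneg fun _ _ => sq_nonneg _
    have h1 := (setIntegral_eq_zero_iff_of_nonneg_ae hnn (hgi _ hcomp)).1
      (le_antisymm h0 (setIntegral_nonneg_of_ae_restrict hnn))
    exact (ae_restrict_iff' hcomp.measurableSet).1 h1
  filter_upwards [ae_all_iff.2 hball] with x hx i
  obtain ⟨n, hn⟩ := exists_nat_ge ‖x‖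
  have h := hx n (mem_closedBall_zero_iff.2 hn)
  exact pow_eq_zero_iff (two_ne_zero) |>.1
    ((Finset.sum_eq_zero_iff_of_nonneg fun _ _ => sq_nonneg _).1 h i (Finset.mem_univ i))

/-- A function bounded and weakly harmonic near infinity has a gradient whose square integral over
the annulus of radius `R` is `O(R)`: this is the Caccioppoli inequality on a slightly larger
annulus, of volume `O(R^3)`, with a cutoff of gradient `O(R^{-1})`. -/
theorem exists_growth_grad {v : E3 → ℝ} {g : Fin 3 → E3 → ℝ} (hv : IsWeakGrad v g) {R₁ : ℝ}
    (hbdd : ∀ᵐ x, R₁ ≤ ‖x‖ → |v x| ≤ 1)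
    (heq : ∀ ψ : E3 → ℝ, ContDiff ℝ ∞ ψ → HasCompactSupport ψ →
      tsupport ψ ⊆ (Metric.ball (0 : E3) R₁)ᶜ → ∫ x, ∑ i, g i x * pd i ψ x = 0) :
    ∃ C R₀ : ℝ, ∀ R, R₀ ≤ R → ∫ x in annulus R, ∑ i, g i x ^ 2 ≤ C * R := by
  obtain ⟨B, hB0, hB⟩ := exists_abs_pd_cutoff_le
  set V := volume.real (Metric.ball (0 : E3) 1)
  refine ⟨36 * (3 * (5 * B / 2) ^ 2 * (64 * V)), 2 * |R₁| + 1, fun R hR => ?_⟩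
  have hRpos : 0 < R := by linarith [abs_nonneg R₁]
  have hR₁ : R₁ ≤ R / 2 := by linarith [le_abs_self R₁]
  -- `η` is `1` on the annulus, and vanishes for `‖x‖ ≤ R / 2` and for `4 * R ≤ ‖x‖`
  set η : E3 → ℝ := fun x => cutoff (2 * R) x - cutoff (R / 2) x
  have h2R : 0 < 2 * R := by positivity
  have hR2 : 0 < R / 2 := by positivity
  have hη : ContDiff ℝ ∞ η := (contDiff_cutoff _).sub (contDiff_cutoff _)
  have hηs : HasCompactSupport η :=
    (hasCompactSupport_cutoff h2R).sub (hasCompactSupport_cutoff hR2)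
  have hsupp : tsupport η ⊆ (Metric.ball (0 : E3) R₁)ᶜ := by
    refine closure_minimal (fun x hx hxb => hx ?_) Metric.isOpen_ball.isClosed_compl
    rw [mem_ball_zero_iff] at hxb
    simp only [η]
    rw [cutoff_eq_one h2R (by linarith), cutoff_eq_one hR2 (by linarith), sub_self]
  have hpd : ∀ i x, pd i η x = pd i (cutoff (2 * R)) x - pd i (cutoff (R / 2)) x := by
    intro i x
    simp only [pd, η]
    rw [fderiv_fun_sub ((contDiff_cutoff _).differentiable (by simp) x)
      ((contDiff_cutoff _).differentiable (by simp) x)]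
    simp
  have hpdle : ∀ i x, pd i η x ^ 2 ≤ (5 * B / 2 / R) ^ 2 := by
    intro i x
    have h1 := abs_le.1 (hB _ h2R i x)
    have h2 := abs_le.1 (hB _ hR2 i x)
    have h3 : B / (2 * R) + B / (R / 2) = 5 * B / 2 / R := by field_simp; ring
    rw [hpd]
    apply sq_le_sq' <;> linarith [h1.1, h1.2, h2.1, h2.2]
  have hcac := caccioppoli (A := fun _ => 1) (M := 1) (c := 1) (fun _ _ => measurable_const)
    (fun _ i j => by rw [Matrix.one_apply]; split_ifs <;> simp) one_pos
    (fun _ ξ => by simp) hv hη hηs (fun ψ h1 h2 h3 => by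
      simpa only [Matrix.one_mulVec] using heq ψ h1 h2 (h3.trans hsupp))
  have hKc := isCompact_closedBall (0 : E3) (4 * R)
  have hright : ∫ x, v x ^ 2 * ∑ i, pd i η x ^ 2
      ≤ ∫ x, (Metric.closedBall (0 : E3) (4 * R)).indicator
          (fun _ => 3 * (5 * B / 2 / R) ^ 2) x := by
    refine integral_mono_of_nonneg (ae_of_all _ fun x => by positivity) ?_ ?_
    · exact (integrable_indicator_iff hKc.measurableSet).2
        (integrableOn_const hKc.measure_lt_top.ne)
    · filter_upwards [hbdd] with x hx
      rcases lt_or_ge ‖x‖ (R / 2) with h | h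
      · have h0 : ∀ i, pd i η x = 0 := fun i => by
          rw [hpd, pd_cutoff_eq_zero_of_lt h2R (by linarith),
            pd_cutoff_eq_zero_of_lt hR2 h, sub_self]
        have hz : v x ^ 2 * ∑ i, pd i η x ^ 2 = 0 := by simp only [h0]; simp
        rw [hz]
        exact indicator_nonneg (fun _ _ => by positivity) x
      · rcases le_or_gt ‖x‖ (4 * R) with h' | h'
        · rw [indicator_of_mem (mem_closedBall_zero_iff.2 h')]
          have hv1 : v x ^ 2 ≤ 1 := (sq_le_one_iff_abs_le_one _).2 (hx (hR₁.trans h))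
          calc v x ^ 2 * ∑ i, pd i η x ^ 2 ≤ 1 * ∑ _i : Fin 3, (5 * B / 2 / R) ^ 2 :=
                mul_le_mul hv1 (Finset.sum_le_sum fun i _ => hpdle i x) (by positivity) zero_le_one
            _ = 3 * (5 * B / 2 / R) ^ 2 := by simp
        · have h0 : ∀ i, pd i η x = 0 := fun i => by
            rw [hpd, pd_cutoff_eq_zero_of_gt h2R (by linarith),
              pd_cutoff_eq_zero_of_gt hR2 (by linarith), sub_self]
          have hz : v x ^ 2 * ∑ i, pd i η x ^ 2 = 0 := by simp only [h0]; simp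
          rw [hz]
          exact indicator_nonneg (fun _ _ => by positivity) x
  have hvol : volume.real (Metric.closedBall (0 : E3) (4 * R)) = (4 * R) ^ 3 * V := by
    rw [Measure.addHaar_real_closedBall _ _ (by positivity)]
    simp [V]
  rw [integral_indicator hKc.measurableSet, setIntegral_const, hvol, smul_eq_mul] at hright
  have hleft : ∫ x in annulus R, ∑ i, g i x ^ 2 ≤ ∫ x, η x ^ 2 * ∑ i, g i x ^ 2 := by
    rw [← integral_indicator (isCompact_annulus R).measurableSet]
    refine integral_mono_of_nonneg (ae_of_all _ fun x => ?_) ?_ (ae_of_all _ fun x => ?_)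
    · exact indicator_nonneg (fun _ _ => Finset.sum_nonneg fun _ _ => sq_nonneg _) x
    · simp only [Finset.mul_sum, pow_two (g _ _)]
      exact integrable_finsetSum _ fun i _ => MemL2loc.integrable_mul_mul (hη.continuous.pow 2)
          (hηs.comp_left (g := fun t : ℝ => t ^ 2) (by simp))
          (hv.memL2loc_grad i) (hv.memL2loc_grad i)
    · by_cases hx : x ∈ annulus R
      · have h1 : η x = 1 := by
          simp only [η]
          rw [cutoff_eq_one h2R hx.2, cutoff_eq_zero hR2 (by linarith [hx.1]), sub_zero]
        simp only [indicator_of_mem hx, h1]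
        simp
      · rw [indicator_of_notMem hx]
        positivity
  calc _ ≤ _ := hleft
    _ ≤ _ := hcac
    _ ≤ 36 * 1 ^ 2 / 1 ^ 2 * ((4 * R) ^ 3 * V * (3 * (5 * B / 2 / R) ^ 2)) := by gcongr
    _ = _ := by field_simp; ring

/-! ### Decaying functions with vanishing Hessian -/

theorem clm_ext_single {L L' : E3 →L[ℝ] ℝ}
    (h : ∀ i, L (EuclideanSpace.single i 1) = L' (EuclideanSpace.single i 1)) : L = L' := by
  apply ContinuousLinearMap.coe_injective
  refine (EuclideanSpace.basisFun (Fin 3) ℝ).toBasis.ext fun i => ?_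
  simpa using h i

theorem eq_const_of_pd_eq_zero {ψ : E3 → ℝ} (hψ : ContDiff ℝ ∞ ψ)
    (h : ∀ i x, pd i ψ x = 0) (x y : E3) : ψ x = ψ y :=
  is_const_of_fderiv_eq_zero (𝕜 := ℝ) (hψ.differentiable (by simp))
    (fun z => clm_ext_single fun i => by simpa using h i z) x y

/-- A smooth function with vanishing Hessian that tends to zero at infinity is zero, being
affine. -/
theorem eq_zero_of_pd_pd_eq_zero {G : E3 → ℝ} (hG : ContDiff ℝ ∞ G)
    (h : ∀ i j x, pd i (pd j G) x = 0)
    (hdecay : ∀ δ : ℝ, 0 < δ → ∃ R : ℝ, ∀ x, R ≤ ‖x‖ → |G x| ≤ δ) (x : E3) : G x = 0 := by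
  set L := fderiv ℝ G 0
  have hL : ∀ x, fderiv ℝ G x = L := fun x => clm_ext_single fun j =>
    eq_const_of_pd_eq_zero (contDiff_pd hG j) (fun i => h i j) x 0
  have haff : ∀ x, G x = L x + G 0 := by
    intro x
    have hd : Differentiable ℝ G := hG.differentiable (by simp)
    have hc := is_const_of_fderiv_eq_zero (𝕜 := ℝ) (f := fun y => G y - L y)
      (hd.sub L.differentiable) (fun y => by
        rw [fderiv_fun_sub (hd y) L.differentiableAt, hL, L.fderiv, sub_self]) x 0
    simp only [map_zero, sub_zero] at hc
    linarith
  -- along every ray `G` is affine and tends to zero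
  have hray : ∀ x, x ≠ 0 → Tendsto (fun n : ℕ => G ((n : ℝ) • x)) atTop (𝓝 0) := by
    intro x hx
    rw [Metric.tendsto_atTop]
    intro δ hδ
    obtain ⟨R, hR⟩ := hdecay (δ / 2) (by positivity)
    obtain ⟨N, hN⟩ := exists_nat_ge (R / ‖x‖)
    refine ⟨N, fun n hn => ?_⟩
    rw [Real.dist_eq, sub_zero]
    have hxn : 0 < ‖x‖ := norm_pos_iff.2 hx
    have h1 : R ≤ ‖(n : ℝ) • x‖ := by
      rw [norm_smul, Real.norm_natCast]
      rw [div_le_iff₀ hxn] at hN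
      refine hN.trans ?_
      gcongr
    linarith [hR _ h1]
  have hLzero : ∀ x, L x = 0 := by
    intro x
    by_cases hx : x = 0
    · simp [hx]
    have h1 := ((hray x hx).comp (tendsto_add_atTop_nat 1)).sub (hray x hx)
    have h2 : ∀ n : ℕ, ((fun n : ℕ => G ((n : ℝ) • x)) ∘ fun a => a + 1) n - G ((n : ℝ) • x)
        = L x := by
      intro n
      simp only [Function.comp]
      rw [haff, haff ((n : ℝ) • x), map_smul, map_smul]
      push_cast
      simp only [smul_eq_mul]
      ring
    simp only [h2, sub_zero] at h1
    exact tendsto_nhds_unique tendsto_const_nhds h1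
  have hconst : ∀ y, G y = G 0 := fun y => by rw [haff, hLzero, zero_add]
  have hne : EuclideanSpace.single (0 : Fin 3) (1 : ℝ) ≠ 0 := by
    intro h0
    have := congrArg norm h0
    simp at this
  have h1 := hray _ hne
  simp only [hconst ((_ : ℝ) • _)] at h1
  rw [hconst]
  exact tendsto_nhds_unique tendsto_const_nhds h1

/-- The mollifications of `u` inherit both the vanishing Hessian and the decay. -/
theorem ae_eq_zero_of_hessian_eq_zero {u : E3 → ℝ} {g : Fin 3 → E3 → ℝ}
    {h : Fin 3 → Fin 3 → E3 → ℝ} (hu : IsWeakGrad u g) (hg : ∀ j, IsWeakGrad (g j) (h j))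
    (hzero : ∀ j l, h j l =ᵐ[volume] 0)
    (hdecay : ∀ δ : ℝ, 0 < δ → ∃ R : ℝ, ∀ᵐ x, R ≤ ‖x‖ → |u x| ≤ δ) : u =ᵐ[volume] 0 := by
  have hloc := hu.memL2loc.locallyIntegrable
  have hm : ∀ k x, moll k u x = 0 := by
    intro k
    refine eq_zero_of_pd_pd_eq_zero (contDiff_moll k hloc) (fun i j x => ?_) fun δ hδ => ?_
    · have e1 := pd_moll k (hu.hasWeakPartial j)
      have e2 := pd_moll k ((hg j).hasWeakPartial i)
      rw [e1, e2, moll_congr k (hzero j i)]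
      simp [moll]
    · obtain ⟨R, hR⟩ := hdecay δ hδ
      refine ⟨R + 1, fun x hx => abs_moll_le ?_⟩
      filter_upwards [hR] with t ht hxt
      exact ht (by linarith [norm_sub_norm_le x t])
  filter_upwards [ae_tendsto_moll hloc] with x hx
  simp only [hm] at hx
  exact (tendsto_nhds_unique hx tendsto_const_nhds)

/-! ### Weak Hessians -/

namespace IsWeakGrad

theorem sub {u v : E3 → ℝ} {f g : Fin 3 → E3 → ℝ} (hu : IsWeakGrad u f) (hv : IsWeakGrad v g) :
    IsWeakGrad (fun x => u x - v x) (fun i x => f i x - g i x) :=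
  ⟨hu.memL2loc.sub hv.memL2loc, fun i => (hu.memL2loc_grad i).sub (hv.memL2loc_grad i),
    fun i => (hu.hasWeakPartial i).sub (hv.hasWeakPartial i)⟩

theorem sum {u : Fin 3 → E3 → ℝ} {g : Fin 3 → Fin 3 → E3 → ℝ}
    (h : ∀ j, IsWeakGrad (u j) (g j)) :
    IsWeakGrad (fun x => ∑ j, u j x) (fun i x => ∑ j, g j i x) :=
  ⟨MemL2loc.sum fun j => (h j).memL2loc, fun i => MemL2loc.sum fun j => (h j).memL2loc_grad i,
    fun i => HasWeakPartial.sum fun j => (h j).hasWeakPartial i⟩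

end IsWeakGrad

theorem MemHloc.exists_hessian {u : E3 → ℝ} (hu : MemHloc 2 u) :
    ∃ (g : Fin 3 → E3 → ℝ) (h : Fin 3 → Fin 3 → E3 → ℝ),
      IsWeakGrad u g ∧ ∀ j, IsWeakGrad (g j) (h j) := by
  obtain ⟨h0, h1⟩ := hu
  choose g hg hg' using h1
  choose h hh hh' using fun j => (hg' j).2
  exact ⟨g, h, ⟨h0, fun j => (hg' j).1, hg⟩, fun j => ⟨(hg' j).1, hh' j, hh j⟩⟩

/-- The Laplacian, built from arbitrarily chosen weak derivatives, is the trace of any weak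
Hessian. -/
theorem weakLaplacian_ae_eq {u : E3 → ℝ} {g : Fin 3 → E3 → ℝ} {h : Fin 3 → Fin 3 → E3 → ℝ}
    (hu : IsWeakGrad u g) (hg : ∀ j, IsWeakGrad (g j) (h j)) :
    weakLaplacian univ u =ᵐ[volume] fun x => ∑ j, h j j x := by
  have h1 : ∀ j, weakPartial univ j (weakPartial univ j u) =ᵐ[volume] h j j := fun j =>
    ((hg j).hasWeakPartial j).weakPartial_ae_eq
      ((hu.hasWeakPartial j).weakPartial_ae_eq EventuallyEq.rfl)
  filter_upwards [ae_all_iff.2 h1] with x hx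
  simp only [weakLaplacian, hx]

theorem weakGradDiv_ae_eq {F : E3 → E3} {g : Fin 3 → Fin 3 → E3 → ℝ}
    {h : Fin 3 → Fin 3 → Fin 3 → E3 → ℝ} (hF : ∀ i, IsWeakGrad (fun x => F x i) (g i))
    (hg : ∀ i j, IsWeakGrad (g i j) (h i j)) :
    ∀ᵐ x, weakGradDiv univ F x = fun l => ∑ j, h j j l x := by
  have h1 : weakDiv univ F =ᵐ[volume] fun x => ∑ j, g j j x := by
    have h2 : ∀ j, weakPartial univ j (fun y => F y j) =ᵐ[volume] g j j := fun j =>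
      ((hF j).hasWeakPartial j).weakPartial_ae_eq EventuallyEq.rfl
    filter_upwards [ae_all_iff.2 h2] with x hx
    simp only [weakDiv, hx]
  have h3 : ∀ l, weakPartial univ l (weakDiv univ F) =ᵐ[volume] fun x => ∑ j, h j j l x :=
    fun l => ((IsWeakGrad.sum fun j => hg j j).hasWeakPartial l).weakPartial_ae_eq h1
  filter_upwards [ae_all_iff.2 h3] with x hx
  funext l
  exact hx l

section

variable {u : E3 → ℝ} {g : Fin 3 → E3 → ℝ} {h : Fin 3 → Fin 3 → E3 → ℝ}

theorem integral_hessian_mul (hu : IsWeakGrad u g) (hg : ∀ j, IsWeakGrad (g j) (h j))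
    {ψ : E3 → ℝ} (hψ : ContDiff ℝ ∞ ψ) (hψs : HasCompactSupport ψ) (j l : Fin 3) :
    ∫ x, h j l x * ψ x = ∫ x, u x * pd j (pd l ψ) x := by
  rw [(hu.hasWeakPartial j).integral_pd (contDiff_pd hψ l) (hasCompactSupport_pd hψs l),
    ((hg j).hasWeakPartial l).integral_pd hψ hψs, neg_neg]

/-- Third derivatives commute, in weak form. -/
theorem integral_hessian_mul_pd_comm (hu : IsWeakGrad u g) (hg : ∀ j, IsWeakGrad (g j) (h j))
    {ψ : E3 → ℝ} (hψ : ContDiff ℝ ∞ ψ) (hψs : HasCompactSupport ψ) (m l : Fin 3) :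
    ∫ x, h m l x * pd l ψ x = ∫ x, h l l x * pd m ψ x := by
  rw [integral_hessian_mul hu hg (contDiff_pd hψ l) (hasCompactSupport_pd hψs l),
    integral_hessian_mul hu hg (contDiff_pd hψ m) (hasCompactSupport_pd hψs m),
    pd_comm (contDiff_pd hψ l) m l, pd_comm hψ m l]

/-- The partial derivatives of a weakly harmonic function are weakly harmonic. -/
theorem integral_grad_partial_eq_zero (hu : IsWeakGrad u g) (hg : ∀ j, IsWeakGrad (g j) (h j))
    (hharm : ∀ᵐ x, ∑ j, h j j x = 0)
    {ψ : E3 → ℝ} (hψ : ContDiff ℝ ∞ ψ) (hψs : HasCompactSupport ψ) (m : Fin 3) :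
    ∫ x, ∑ l, h m l x * pd l ψ x = 0 := by
  have hint : ∀ j l m, Integrable (fun x => h j l x * pd m ψ x) := fun j l m =>
    MemL2loc.integrable_mul (contDiff_pd hψ m).continuous (hasCompactSupport_pd hψs m)
      ((hg j).memL2loc_grad l)
  rw [integral_finsetSum _ fun l _ => hint m l l]
  simp only [integral_hessian_mul_pd_comm hu hg hψ hψs m]
  rw [← integral_finsetSum _ fun l _ => hint l l m]
  refine integral_eq_zero_of_ae ?_
  filter_upwards [hharm] with x hx
  rw [← Finset.sum_mul, hx, zero_mul, Pi.zero_apply]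

/-- A function that is harmonic almost everywhere off a ball is weakly harmonic there. -/
theorem integral_grad_eq_zero_of_harmonic_off_ball (hu : IsWeakGrad u g)
    (hg : ∀ j, IsWeakGrad (g j) (h j)) {R : ℝ} (hharm : ∀ᵐ x, R ≤ ‖x‖ → ∑ j, h j j x = 0)
    {ψ : E3 → ℝ} (hψ : ContDiff ℝ ∞ ψ) (hψs : HasCompactSupport ψ)
    (hsupp : tsupport ψ ⊆ (Metric.ball (0 : E3) R)ᶜ) :
    ∫ x, ∑ j, g j x * pd j ψ x = 0 := by
  have hint1 : ∀ j, Integrable (fun x => g j x * pd j ψ x) := fun j =>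
    MemL2loc.integrable_mul (contDiff_pd hψ j).continuous (hasCompactSupport_pd hψs j)
      (hu.memL2loc_grad j)
  have hint2 : ∀ j, Integrable (fun x => h j j x * ψ x) := fun j =>
    MemL2loc.integrable_mul hψ.continuous hψs ((hg j).memL2loc_grad j)
  rw [integral_finsetSum _ fun l _ => hint1 l,
    Finset.sum_congr rfl fun j _ => ((hg j).hasWeakPartial j).integral_pd hψ hψs,
    Finset.sum_neg_distrib, ← integral_finsetSum _ fun l _ => hint2 l, neg_eq_zero]
  refine integral_eq_zero_of_ae ?_
  filter_upwards [hharm] with x hx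
  rw [← Finset.sum_mul, Pi.zero_apply]
  rcases lt_or_ge ‖x‖ R with hlt | hge
  · rw [image_eq_zero_of_notMem_tsupport fun hmem =>
      hsupp hmem (mem_ball_zero_iff.2 hlt), mul_zero]
  · rw [hx hge, zero_mul]

end

/-! ### Uniqueness -/

/-- If `ΔF + (ε - I)∇∇·F = 0`, then `ε∇(∇·F) = ∇∇·F - ΔF` is weakly divergence free, because
`Δ` commutes with the divergence. -/
theorem integral_coefficient_gradDiv_eq_zero {ε : E3 → Matrix (Fin 3) (Fin 3) ℝ}
    {F : Fin 3 → E3 → ℝ} {g : Fin 3 → Fin 3 → E3 → ℝ} {h : Fin 3 → Fin 3 → Fin 3 → E3 → ℝ}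
    (hF : ∀ i, IsWeakGrad (F i) (g i)) (hg : ∀ i j, IsWeakGrad (g i j) (h i j))
    (heq : ∀ᵐ x, ∀ i, ∑ j, h i j j x + ((ε x - 1) *ᵥ fun l => ∑ j, h j j l x) i = 0)
    {ψ : E3 → ℝ} (hψ : ContDiff ℝ ∞ ψ) (hψs : HasCompactSupport ψ) :
    ∫ x, ∑ i, (ε x *ᵥ fun l => ∑ j, h j j l x) i * pd i ψ x = 0 := by
  have hint : ∀ i j l m, Integrable (fun x => h i j l x * pd m ψ x) := fun i j l m =>
    MemL2loc.integrable_mul (contDiff_pd hψ m).continuous (hasCompactSupport_pd hψs m)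
      ((hg i j).memL2loc_grad l)
  have h1 : ∫ x, ∑ i, (ε x *ᵥ fun l => ∑ j, h j j l x) i * pd i ψ x
      = ∫ x, ∑ i, ∑ j, (h j j i x * pd i ψ x - h i j j x * pd i ψ x) := by
    refine integral_congr_ae ?_
    filter_upwards [heq] with x hx
    refine Finset.sum_congr rfl fun i _ => ?_
    have h2 := hx i
    rw [Matrix.sub_mulVec, Matrix.one_mulVec, Pi.sub_apply] at h2
    rw [Finset.sum_sub_distrib, ← Finset.sum_mul, ← Finset.sum_mul, ← sub_mul]
    congr 1
    linarith
  have hint2 : ∀ i j, Integrable fun x => h j j i x * pd i ψ x - h i j j x * pd i ψ x :=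
    fun i j => (hint j j i i).sub (hint i j j i)
  have h3 : ∀ i, ∫ x, ∑ j, (h j j i x * pd i ψ x - h i j j x * pd i ψ x)
      = ∑ j, (∫ x, h j j i x * pd i ψ x) - ∑ j, ∫ x, h i j j x * pd i ψ x := fun i => by
    rw [integral_finsetSum _ fun j _ => hint2 i j, ← Finset.sum_sub_distrib]
    exact Finset.sum_congr rfl fun j _ => integral_sub (hint j j i i) (hint i j j i)
  rw [h1, integral_finsetSum _ fun i _ => integrable_finsetSum _ fun j _ => hint2 i j,
    Finset.sum_congr rfl fun i _ => h3 i, Finset.sum_sub_distrib]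
  rw [sub_eq_zero, Finset.sum_comm]
  refine Finset.sum_congr rfl fun j _ => Finset.sum_congr rfl fun i _ => ?_
  exact integral_hessian_mul_pd_comm (hF j) (hg j) hψ hψs j i

/-- Without incoming field the scattering problem has only the zero solution. The square
integrals of the derivatives of `F` over annuli are `O(R)`, so the Liouville theorem applies to
the divergence (with coefficient `ε`) and then, `F` being harmonic, to every partial derivative. -/
theorem ae_eq_zero_of_homogeneous {ε : E3 → Matrix (Fin 3) (Fin 3) ℝ} (hε : IsCoefficient ε)
    {F : Fin 3 → E3 → ℝ} {g : Fin 3 → Fin 3 → E3 → ℝ} {h : Fin 3 → Fin 3 → Fin 3 → E3 → ℝ}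
    (hF : ∀ i, IsWeakGrad (F i) (g i)) (hg : ∀ i j, IsWeakGrad (g i j) (h i j))
    (heq : ∀ᵐ x, ∀ i, ∑ j, h i j j x + ((ε x - 1) *ᵥ fun l => ∑ j, h j j l x) i = 0)
    (hdecay : ∀ δ : ℝ, 0 < δ → ∃ R : ℝ, ∀ᵐ x, R ≤ ‖x‖ → ∀ i, |F i x| ≤ δ) (i : Fin 3) :
    F i =ᵐ[volume] 0 := by
  obtain ⟨M, hM⟩ := hε.bounded
  obtain ⟨c, hc, hell⟩ := hε.elliptic
  obtain ⟨ρ, hρ⟩ := hε.compactSupport.isBounded.subset_closedBall (0 : E3)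
  obtain ⟨ρ', hρ'⟩ := hdecay 1 one_pos
  have hone : ∀ x : E3, ρ < ‖x‖ → ε x - 1 = 0 := fun x hx => by
    refine image_eq_zero_of_notMem_tsupport (f := fun x => ε x - 1) fun hmem => ?_
    have := mem_closedBall_zero_iff.1 (hρ hmem)
    linarith
  have hgrowth : ∀ i, ∃ C R₀ : ℝ, ∀ R, R₀ ≤ R → ∫ x in annulus R, ∑ j, g i j x ^ 2 ≤ C * R := by
    intro i
    refine exists_growth_grad (hF i) (R₁ := max (ρ + 1) ρ') ?_ fun ψ h1 h2 h3 =>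
      integral_grad_eq_zero_of_harmonic_off_ball (hF i) (hg i) ?_ h1 h2 h3
    · filter_upwards [hρ'] with x hx hx'
      exact hx ((le_max_right _ _).trans hx') i
    · filter_upwards [heq] with x hx hx'
      have h1 := hx i
      rw [hone x (by linarith [(le_max_left (ρ + 1) ρ').trans hx'])] at h1
      simpa using h1
  choose C R₀ hCR using hgrowth
  have hsq : ∀ i j R, IntegrableOn (fun x => g i j x ^ 2) (annulus R) := fun i j R =>
    (hg i j).memL2loc.integrableOn_sq (isCompact_annulus R)
  have hsqs : ∀ i R, IntegrableOn (fun x => ∑ j, g i j x ^ 2) (annulus R) := fun i R =>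
    integrable_finsetSum _ fun j _ => hsq i j R
  -- the divergence of `F` solves the scalar equation, and has small growth
  have hD : IsWeakGrad (fun x => ∑ j, g j j x) (fun l x => ∑ j, h j j l x) :=
    IsWeakGrad.sum fun j => hg j j
  have hDgrowth : ∀ R, ∑ i, |R₀ i| ≤ R →
      ∫ x in annulus R, (∑ j, g j j x) ^ 2 ≤ (3 * ∑ i, C i) * R := by
    intro R hR
    have hRi : ∀ i, R₀ i ≤ R := fun i => (le_abs_self _).trans
      ((Finset.single_le_sum (f := fun i => |R₀ i|) (fun _ _ => abs_nonneg _)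
        (Finset.mem_univ i)).trans hR)
    calc ∫ x in annulus R, (∑ j, g j j x) ^ 2
        ≤ ∫ x in annulus R, 3 * ∑ i, ∑ j, g i j x ^ 2 := by
          refine integral_mono (hD.memL2loc.integrableOn_sq (isCompact_annulus R))
            ((integrable_finsetSum _ fun i _ => hsqs i R).const_mul 3) fun x => ?_
          have h1 : (∑ j, g j j x) ^ 2 ≤ 3 * ∑ j, g j j x ^ 2 := by
            simpa using sq_sum_le_card_mul_sum_sq (s := Finset.univ) (f := fun j => g j j x)
          refine h1.trans ?_
          gcongr with i
          exact Finset.single_le_sum (f := fun j => g i j x ^ 2) (fun _ _ => sq_nonneg _)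
            (Finset.mem_univ i)
      _ = 3 * ∑ i, ∫ x in annulus R, ∑ j, g i j x ^ 2 := by
          rw [integral_const_mul, integral_finsetSum _ fun i _ => hsqs i R]
      _ ≤ 3 * ∑ i, C i * R := by
          gcongr with i
          exact hCR i R (hRi i)
      _ = _ := by rw [← Finset.sum_mul, mul_assoc]
  have hDzero := ae_grad_eq_zero_of_growth hε.measurable hM hc hell hD
    (fun ψ h1 h2 => integral_coefficient_gradDiv_eq_zero hF hg heq h1 h2) hDgrowth
  -- hence `F` is harmonic, and so are its partial derivatives, again of small growth
  have hharm : ∀ᵐ x, ∑ j, h i j j x = 0 := by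
    filter_upwards [heq, hDzero] with x hx hx0
    have h1 := hx i
    have h2 : (fun l => ∑ j, h j j l x) = 0 := funext hx0
    rwa [h2, Matrix.mulVec_zero, Pi.zero_apply, add_zero] at h1
  have hHess : ∀ m, ∀ᵐ x, ∀ l, h i m l x = 0 := by
    intro m
    refine ae_grad_eq_zero_of_growth (A := fun _ => 1) (M := 1) (c := 1) (C := C i) (R₀ := R₀ i)
      (fun _ _ => measurable_const)
      (fun _ i j => by rw [Matrix.one_apply]; split_ifs <;> simp) one_pos
      (fun _ ξ => by simp) (hg i m) (fun ψ h1 h2 => ?_) fun R hR => ?_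
    · simpa only [Matrix.one_mulVec] using
        integral_grad_partial_eq_zero (hF i) (hg i) hharm h1 h2 m
    · refine le_trans ?_ (hCR i R hR)
      exact integral_mono (hsq i m R) (hsqs i R) fun x =>
        Finset.single_le_sum (f := fun j => g i j x ^ 2) (fun _ _ => sq_nonneg _)
          (Finset.mem_univ m)
  refine ae_eq_zero_of_hessian_eq_zero (hF i) (hg i) (fun m l => ?_) fun δ hδ => ?_
  · filter_upwards [hHess m] with x hx using hx l
  · obtain ⟨R, hR⟩ := hdecay δ hδ
    exact ⟨R, by filter_upwards [hR] with x hx hx' using hx hx' i⟩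

end Electrostatic


theorem mainTheorem2
    (ε : Electrostatic.E3 → Matrix (Fin 3) (Fin 3) ℝ) (hε : Electrostatic.IsCoefficient ε)
    (U : Set Electrostatic.E3) (Finc : Electrostatic.E3 → Electrostatic.E3)
    (hFinc : Electrostatic.IsIncoming ε U Finc)
    (F₁ F₂ : Electrostatic.E3 → Electrostatic.E3)
    (h₁ : Electrostatic.IsVectorSolution ε U Finc F₁)
    (h₂ : Electrostatic.IsVectorSolution ε U Finc F₂) :
    F₁ =ᵐ[volume] F₂ := by
  choose g₁ k₁ hg₁ hk₁ using fun i => (h₁.memH2loc i).exists_hessian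
  choose g₂ k₂ hg₂ hk₂ using fun i => (h₂.memH2loc i).exists_hessian
  have hzero := Electrostatic.ae_eq_zero_of_homogeneous hε
    (F := fun i x => F₁ x i - F₂ x i)
    (fun i => (hg₁ i).sub (hg₂ i)) (fun i j => (hk₁ i j).sub (hk₂ i j)) ?_ ?_
  · filter_upwards [ae_all_iff.2 hzero] with x hx
    ext i
    exact sub_eq_zero.1 (hx i)
  · have hL₁ := ae_all_iff.2 fun i => Electrostatic.weakLaplacian_ae_eq (hg₁ i) (hk₁ i)
    have hL₂ := ae_all_iff.2 fun i => Electrostatic.weakLaplacian_ae_eq (hg₂ i) (hk₂ i)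
    filter_upwards [h₁.equation, h₂.equation, hL₁, hL₂,
      Electrostatic.weakGradDiv_ae_eq hg₁ hk₁, Electrostatic.weakGradDiv_ae_eq hg₂ hk₂]
      with x e₁ e₂ l₁ l₂ d₁ d₂ i
    have e := congrFun (e₁.trans e₂.symm) i
    simp only [Pi.add_apply, Electrostatic.weakVecLaplacian, l₁, l₂, d₁, d₂] at e
    have hsub : (fun l => ∑ j, (k₁ j j l x - k₂ j j l x))
        = (fun l => ∑ j, k₁ j j l x) - fun l => ∑ j, k₂ j j l x := by
      funext l
      simp [Finset.sum_sub_distrib]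
    rw [hsub, Matrix.mulVec_sub, Pi.sub_apply, Finset.sum_sub_distrib]
    linarith
  · intro δ hδ
    obtain ⟨R₁, hR₁⟩ := h₁.decay (δ / 2) (by positivity)
    obtain ⟨R₂, hR₂⟩ := h₂.decay (δ / 2) (by positivity)
    refine ⟨max R₁ R₂, ?_⟩
    filter_upwards [hR₁, hR₂] with x hx₁ hx₂ hx i
    have b₁ := (PiLp.norm_apply_le (F₁ x) i).trans (hx₁ ((le_max_left _ _).trans hx))
    have b₂ := (PiLp.norm_apply_le (F₂ x) i).trans (hx₂ ((le_max_right _ _).trans hx))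
    have := norm_sub_le (F₁ x i) (F₂ x i)
    rw [← Real.norm_eq_abs]
    linarith
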